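/- Let $R$ be a two-sided noetherian (not necessarily commutative) ring. Let $\mathcal K(\operatorname{proj} R)$ be the homotopy category of (unbounded) complexes of finitely generated projective right $R$-modules, and let $(-)^\ast=\operatorname{Hom}_R(-,R):\mathcal K(\operatorname{proj} R)\to\mathcal K(\operatorname{proj} R^{\mathrm{op}})$ be the $R$-dual, so that $(X^\ast)^i=(X^{-i})^\ast$. For a complex $X$ let $C^i(X)=\operatorname{Coker}(X^{i-1}\to X^i)$. A triangle $X\to Y\to Z\to X[1]$ in $\mathcal K(\operatorname{proj} R)$ or in $\mathcal K(\operatorname{proj} R^{\mathrm{op}})$ is called cohomologically ghost if $0\to \mathrm H^i(X)\to \mathrm H^i(Y)\to \mathrm H^i(Z)\to 0$ is exact for all $i\in\mathbb Z$. Let $\operatorname{Add} R$ be the smallest full subcategory of $\mathcal K(\operatorname{proj} R)$ that contains $R$ (in degree $0$) and is closed under shifts, direct summands and those coproducts that exist in $\mathcal K(\operatorname{proj} R)$. For an object $X$ of $\mathcal K(\operatorname{proj} R)$ and an integer $n\ge 1$, the following are equivalent. (1) $X$ is $n$-torsionfree, i.e. $\operatorname{Ext}^j_{R^{\mathrm{op}}}(C^i(X^\ast),R)=0$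 for all $i\in\mathbb Z$ and all $1\le j\le n$. (2) There are objects $X_0,\dots,X_n$ of $\mathcal K(\operatorname{proj} R)$ and objects $P_0,\dots,P_{n-1}$ of $\operatorname{Add} R$ such that $X\cong X_0$ in $\mathcal K(\operatorname{proj} R)$ and, for each $0\le i\le n-1$, there is a cohomologically ghost triangle $X_i\to P_i\to X_{i+1}\to X_i[1]$ whose $R$-dual triangle $X_{i+1}^\ast\to P_i^\ast\to X_i^\ast\to X_{i+1}^\ast[1]$ is also cohomologically ghost. -/

import Mathlib

open CategoryTheory Limits Pretriangulated Opposite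

universe u

namespace StableComplex

/-- The finitely generated projective modules over a ring `A`. Here a right module over a ring `R`
is a module over `A = Rᵐᵒᵖ`, and a left `R`-module, i.e. a right `Rᵐᵒᵖ`-module, is a module over
`A = R`. -/
def fgProjective (A : Type u) [Ring A] : ObjectProperty (ModuleCat.{u} A) :=
  fun M => Module.Finite A M ∧ Module.Projective A M

instance (A : Type u) [Ring A] : (fgProjective A).IsClosedUnderIsomorphisms where
  of_iso e h := by
    obtain ⟨h₁, h₂⟩ := h
    exact ⟨Module.Finite.equiv e.toLinearEquiv, Module.Projective.of_equiv e.toLinearEquiv⟩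

instance (A : Type u) [Ring A] : (fgProjective A).ContainsZero where
  exists_zero := ⟨ModuleCat.of A PUnit.{u+1}, ModuleCat.isZero_of_subsingleton _,
    ⟨inferInstanceAs (Module.Finite A PUnit.{u+1}), inferInstanceAs (Module.Projective A PUnit.{u+1})⟩⟩

instance (A : Type u) [Ring A] : (fgProjective A).IsClosedUnderBinaryProducts where
  limitsOfShape_le := by
    rintro X ⟨p⟩
    obtain ⟨h₁, h₂⟩ := p.prop_diag_obj ⟨WalkingPair.left⟩
    obtain ⟨h₃, h₄⟩ := p.prop_diag_obj ⟨WalkingPair.right⟩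
    let e : p.diag ≅ pair (p.diag.obj ⟨.left⟩) (p.diag.obj ⟨.right⟩) := diagramIsoPair _
    let e' : X ≅ ModuleCat.of A (p.diag.obj ⟨.left⟩ × p.diag.obj ⟨.right⟩) :=
      (p.isLimit.conePointsIsoOfNatIso (limit.isLimit _) e) ≪≫
        (biprod.isoProd _ _).symm ≪≫ ModuleCat.biprodIsoProd _ _
    refine (fgProjective A).prop_of_iso e'.symm ⟨?_, ?_⟩
    · exact inferInstanceAs (Module.Finite A (p.diag.obj ⟨.left⟩ × p.diag.obj ⟨.right⟩))
    · exact inferInstanceAs (Module.Projective A (p.diag.obj ⟨.left⟩ × p.diag.obj ⟨.right⟩))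

instance (A : Type u) [Ring A] : (fgProjective A).IsClosedUnderFiniteProducts := .mk'

/-- The category `proj A` of finitely generated projective `A`-modules. -/
abbrev Proj (A : Type u) [Ring A] := (fgProjective A).FullSubcategory

instance (A : Type u) [Ring A] : HasBinaryBiproducts (Proj A) :=
  HasBinaryBiproducts.of_hasBinaryProducts

/-- The homotopy category `K(proj A)` of (unbounded, cohomologically graded) complexes of
finitely generated projective `A`-modules. -/
abbrev KProj (A : Type u) [Ring A] := HomotopyCategory (Proj A) (ComplexShape.up ℤ)

/-- The `i`-th cohomology module `H^i` of an object of `K(proj A)`. -/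
noncomputable def cohomology (A : Type u) [Ring A] (i : ℤ) : KProj A ⥤ ModuleCat.{u} A :=
  (fgProjective A).ι.mapHomotopyCategory (ComplexShape.up ℤ) ⋙
    HomotopyCategory.homologyFunctor (ModuleCat.{u} A) (ComplexShape.up ℤ) i

/-- The module `C^i(X)`, the cokernel of the differential `X^{i-1} ⟶ X^i`. -/
noncomputable def cokernelModule {A : Type u} [Ring A] (X : KProj A) (i : ℤ) : ModuleCat.{u} A :=
  (((fgProjective A).ι.mapHomologicalComplex (ComplexShape.up ℤ)).obj X.as).opcycles i

/-- A triangle `X ⟶ Y ⟶ Z ⟶ X⟦1⟧` in `K(proj A)` is cohomologically ghost if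
`0 ⟶ H^i(X) ⟶ H^i(Y) ⟶ H^i(Z) ⟶ 0` is exact for all integers `i`. -/
structure IsCohomologicallyGhost {A : Type u} [Ring A] (T : Triangle (KProj A)) : Prop where
  distinguished : T ∈ distTriang (KProj A)
  shortExact (i : ℤ) :
    ∃ w : (cohomology A i).map T.mor₁ ≫ (cohomology A i).map T.mor₂ = 0,
      (ShortComplex.mk ((cohomology A i).map T.mor₁) ((cohomology A i).map T.mor₂) w).ShortExact

/-- The regular module, as an object of `proj A`. For `A = Rᵐᵒᵖ` this is the right module `R`. -/
def regularModule (A : Type u) [Ring A] : Proj A :=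
  ⟨ModuleCat.of A A, inferInstanceAs (Module.Finite A A), inferInstanceAs (Module.Projective A A)⟩

/-- The regular module, as a complex concentrated in degree `0`. -/
noncomputable def regularComplex (A : Type u) [Ring A] : KProj A :=
  (HomotopyCategory.quotient (Proj A) (ComplexShape.up ℤ)).obj
    ((HomologicalComplex.single (Proj A) (ComplexShape.up ℤ) 0).obj (regularModule A))

/-- `AddR A` is the intersection of all full subcategories of `K(proj A)` which contain the regular
module and are closed under shifts, direct summands and those coproducts (of arbitrary families)
which exist in `K(proj A)`. -/
def AddR (A : Type u) [Ring A] : ObjectProperty (KProj A) := fun X =>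
  ∀ P : ObjectProperty (KProj A), P (regularComplex A) → P.IsStableUnderShift ℤ →
    P.IsStableUnderRetracts →
    (∀ J : Type u, P.IsClosedUnderColimitsOfShape (Discrete J)) → P X

section dual
variable (R : Type u) [Ring R]

theorem dual_finite (M : Type u) [AddCommGroup M] [Module Rᵐᵒᵖ M] [Module.Finite Rᵐᵒᵖ M]
    [Module.Projective Rᵐᵒᵖ M] : Module.Finite R (M →ₗ[Rᵐᵒᵖ] R) ∧ Module.Projective R (M →ₗ[Rᵐᵒᵖ] R) := by
  obtain ⟨n, f, g, hf, hg, h⟩ := Module.Finite.exists_comp_eq_id_of_projective Rᵐᵒᵖ M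
  let e : (Fin n → R) ≃ₗ[R] ((Fin n → Rᵐᵒᵖ) →ₗ[Rᵐᵒᵖ] R) := (Pi.basisFun Rᵐᵒᵖ (Fin n)).constr R
  have : Module.Finite R ((Fin n → Rᵐᵒᵖ) →ₗ[Rᵐᵒᵖ] R) := .equiv e
  have : Module.Projective R ((Fin n → Rᵐᵒᵖ) →ₗ[Rᵐᵒᵖ] R) := .of_equiv e
  let i : (M →ₗ[Rᵐᵒᵖ] R) →ₗ[R] ((Fin n → Rᵐᵒᵖ) →ₗ[Rᵐᵒᵖ] R) :=
    { toFun φ := φ ∘ₗ f, map_add' _ _ := rfl, map_smul' _ _ := rfl }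
  let s : ((Fin n → Rᵐᵒᵖ) →ₗ[Rᵐᵒᵖ] R) →ₗ[R] (M →ₗ[Rᵐᵒᵖ] R) :=
    { toFun φ := φ ∘ₗ g, map_add' _ _ := rfl, map_smul' _ _ := rfl }
  have his : s ∘ₗ i = LinearMap.id := by
    ext φ x
    exact congrArg φ (LinearMap.congr_fun h x)
  exact ⟨.of_surjective s fun φ => ⟨i φ, LinearMap.congr_fun his φ⟩, .of_split i s his⟩

/-- The `R`-dual, sending a right `R`-module `M` to the left `R`-module `Hom_R(M, R)`, with
`(r • φ) x = r * φ x`. -/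
def dual : (Proj Rᵐᵒᵖ)ᵒᵖ ⥤ Proj R where
  obj M := ⟨ModuleCat.of R (M.unop.obj →ₗ[Rᵐᵒᵖ] R), by
    obtain ⟨_, _⟩ := M.unop.property
    exact dual_finite R M.unop.obj⟩
  map f := ObjectProperty.homMk (ModuleCat.ofHom
    { toFun := fun φ => φ ∘ₗ f.unop.hom.hom
      map_add' := fun _ _ => rfl
      map_smul' := fun _ _ => rfl })

instance : (dual R).Additive where
  map_add {M N f g} := by
    ext : 2
    ext φ
    apply LinearMap.ext
    intro x
    exact map_add (show M.unop.obj →ₗ[Rᵐᵒᵖ] R from φ) (f.unop.hom.hom x) (g.unop.hom.hom x)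

/-- The dual complex `X^*`: in degree `i` it is the dual of `X^{-i}`, and its differentials are the
duals of those of `X` (without signs). -/
noncomputable def dualComplex :
    (CochainComplex (Proj Rᵐᵒᵖ) ℤ)ᵒᵖ ⥤ CochainComplex (Proj R) ℤ :=
  (CochainComplex.opEquivalence _).functor ⋙ (dual R).mapHomologicalComplex _

/-- The duality `X ↦ X^*` from `K(proj R)` (right modules) to `K(proj Rᵐᵒᵖ)` (left modules). -/
noncomputable def dualK : (KProj Rᵐᵒᵖ)ᵒᵖ ⥤ KProj R :=
  (CategoryTheory.Quotient.lift (homotopic (Proj Rᵐᵒᵖ) (ComplexShape.up ℤ))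
    ((dualComplex R).rightOp ⋙ (HomotopyCategory.quotient (Proj R) (ComplexShape.up ℤ)).op)
    (by
      rintro X Y f g ⟨h⟩
      exact congrArg Quiver.Hom.op (HomotopyCategory.eq_of_homotopy _ _
        ((dual R).mapHomotopy (CochainComplex.homotopyOp h))))).leftOp

lemma dualK_map_quotient {X Y : CochainComplex (Proj Rᵐᵒᵖ) ℤ} (f : X ⟶ Y) :
  (dualK R).map ((HomotopyCategory.quotient _ _).map f).op = (HomotopyCategory.quotient _ _).map ((dualComplex R).map f.op) := rfl

/-- The canonical isomorphism `X^* ≅ ((X⟦1⟧)^*)⟦1⟧` for complexes, the identity in each degree. -/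
noncomputable def shiftIsoC (X : CochainComplex (Proj Rᵐᵒᵖ) ℤ) :
    (dualComplex R).obj (op X) ≅ ((dualComplex R).obj (op (X⟦(1 : ℤ)⟧)))⟦(1 : ℤ)⟧ :=
  HomologicalComplex.Hom.isoOfComponents
    (fun i => (dual R).mapIso (X.XIsoOfEq (by lia : -(i + 1) + 1 = -i)).op) (by
      intro i j hij
      change (dual R).map _ ≫ ((1:ℤ).negOnePow • (dual R).map ((1:ℤ).negOnePow • X.d (-(j + 1) + 1) (-(i + 1) + 1)).op) =
        (dual R).map (X.d (-j) (-i)).op ≫ (dual R).map (X.XIsoOfEq _).hom.op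
      simp only [Int.negOnePow_one, Units.neg_smul, one_smul, op_neg, Functor.map_neg, neg_neg]

      simp only [Iso.op_hom, ← Functor.map_comp, ← op_comp]
      simp)

/-- The canonical isomorphism `X^* ≅ ((X⟦1⟧)^*)⟦1⟧` in the homotopy category. -/
noncomputable def shiftIso (X : KProj Rᵐᵒᵖ) :
    (dualK R).obj (op X) ≅ ((dualK R).obj (op (X⟦(1 : ℤ)⟧)))⟦(1 : ℤ)⟧ :=
  (HomotopyCategory.quotient _ _).mapIso (shiftIsoC R X.as) ≪≫
    ((HomotopyCategory.quotient _ _).commShiftIso (1 : ℤ)).app _ ≪≫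
    (shiftFunctor (KProj R) (1 : ℤ)).mapIso ((dualK R).mapIso
      (((HomotopyCategory.quotient _ _).commShiftIso (1 : ℤ)).app X.as).op.symm)

/-- The `R`-dual `Z^* ⟶ Y^* ⟶ X^* ⟶ Z^*⟦1⟧` of a triangle `X ⟶ Y ⟶ Z ⟶ X⟦1⟧`; the last morphism is
the shift of the dual of `Z ⟶ X⟦1⟧`. -/
noncomputable def dualTriangle (T : Triangle (KProj Rᵐᵒᵖ)) : Triangle (KProj R) :=
  Triangle.mk ((dualK R).map T.mor₂.op) ((dualK R).map T.mor₁.op)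
    ((shiftIso R T.obj₁).hom ≫ ((dualK R).map T.mor₃.op)⟦(1 : ℤ)⟧')

lemma aux₁ {C : Type*} [Category* C] {A B D E A' B' D' E' : C} {a : A ⟶ A'} {x : A' ⟶ B'}
    {y : B' ⟶ D'} {z : D' ⟶ E'} {x' : A ⟶ B} {y' : B ⟶ D} {z' : D ⟶ E} {w : E ⟶ E'}
    {m : B ⟶ B'} {n : D ⟶ D'}
    (h₃ : a ≫ x = x' ≫ m) (h₂ : y' ≫ n = m ≫ y) (h₁ : z' ≫ w = n ≫ z) :
    a ≫ x ≫ y ≫ z = (x' ≫ y' ≫ z') ≫ w := by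
  simp only [Category.assoc]
  rw [reassoc_of% h₃, h₁, reassoc_of% h₂]

lemma aux₂ {C : Type*} [Category* C] {A B D E F G : C} {x : A ⟶ B} {y : B ⟶ D} {z : D ⟶ E}
    {w : E ⟶ D} {v : D ⟶ F} {m : B ⟶ G} {y' : G ⟶ F} {t : A ⟶ G} {wv : E ⟶ F}
    (h₀ : wv = w ≫ v)
    (h₁ : z ≫ w = 𝟙 _) (h₂ : y ≫ v = m ≫ y') (h₃ : t = x ≫ m) :
    (x ≫ y ≫ z) ≫ wv = t ≫ y' := by
  simp only [Category.assoc, h₀, h₃]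
  rw [reassoc_of% h₁, h₂]

lemma aux₃ {C : Type*} [Category* C] {A B D E F G : C} {a : A ⟶ B} {x : B ⟶ D} {y : A ⟶ E}
    {z : E ⟶ D} {m : D ⟶ F} {n : E ⟶ G} {l : G ⟶ F} (h : a ≫ x = y ≫ z) (h' : z ≫ m = n ≫ l) :
    (y ≫ n) ≫ l = a ≫ x ≫ m := by
  rw [reassoc_of% h, Category.assoc, h']

lemma shiftIsoC_naturality {X Y : CochainComplex (Proj Rᵐᵒᵖ) ℤ} (f : X ⟶ Y) :
    (dualComplex R).map f.op ≫ (shiftIsoC R X).hom =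
      (shiftIsoC R Y).hom ≫ ((dualComplex R).map (f⟦(1 : ℤ)⟧').op)⟦(1 : ℤ)⟧' := by
  ext i : 1
  refine ((dual R).map_comp _ _).symm.trans (Eq.trans ?_ ((dual R).map_comp _ _))
  refine congrArg (dual R).map (congrArg Quiver.Hom.op ?_)
  have key : ∀ (a b : ℤ) (h : a = b),
      (X.XIsoOfEq h).hom ≫ f.f b = f.f a ≫ (Y.XIsoOfEq h).hom := by
    rintro a b rfl
    exact (Category.id_comp _).trans (Category.comp_id _).symm
  exact key (-(i + 1) + 1) (-i) (by lia)

/-- The shift by `1` of the dual of a morphism. -/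
noncomputable def sdm {X Y : KProj Rᵐᵒᵖ} (f : X ⟶ Y) :
    ((dualK R).obj (op Y))⟦(1 : ℤ)⟧ ⟶ ((dualK R).obj (op X))⟦(1 : ℤ)⟧ :=
  ((dualK R).map f.op)⟦(1 : ℤ)⟧'

lemma sdm_comp {X Y Z : KProj Rᵐᵒᵖ} (f : X ⟶ Y) (g : Y ⟶ Z) :
    sdm R (f ≫ g) = sdm R g ≫ sdm R f := by
  simp [sdm]

lemma sdm_id (X : KProj Rᵐᵒᵖ) : sdm R (𝟙 X) = 𝟙 _ := by
  simp [sdm]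

lemma shiftIso_quotient (X : CochainComplex (Proj Rᵐᵒᵖ) ℤ) :
    (shiftIso R ((HomotopyCategory.quotient _ _).obj X)).hom =
      (HomotopyCategory.quotient _ _).map (shiftIsoC R X).hom ≫
        ((HomotopyCategory.quotient (Proj R) (.up ℤ)).commShiftIso (1 : ℤ)).hom.app _ ≫
          sdm R (((HomotopyCategory.quotient (Proj Rᵐᵒᵖ) (.up ℤ)).commShiftIso (1 : ℤ)).inv.app X) :=
  rfl

lemma comm_sdm {X Y : CochainComplex (Proj Rᵐᵒᵖ) ℤ} (f : X ⟶ Y) :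
    ((HomotopyCategory.quotient (Proj R) (.up ℤ)).commShiftIso (1 : ℤ)).hom.app
        ((dualComplex R).obj (op Y)) ≫ sdm R ((HomotopyCategory.quotient _ _).map f) =
      (HomotopyCategory.quotient _ _).map (((dualComplex R).map f.op)⟦(1 : ℤ)⟧') ≫
        ((HomotopyCategory.quotient (Proj R) (.up ℤ)).commShiftIso (1 : ℤ)).hom.app
          ((dualComplex R).obj (op X)) :=
  (((HomotopyCategory.quotient (Proj R) (.up ℤ)).commShiftIso (1 : ℤ)).hom.naturality
    ((dualComplex R).map f.op)).symm

lemma shiftIso_naturality {X Y : KProj Rᵐᵒᵖ} (f : X ⟶ Y) :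
    (dualK R).map f.op ≫ (shiftIso R X).hom =
      (shiftIso R Y).hom ≫ sdm R (f⟦(1 : ℤ)⟧') := by
  obtain ⟨X, rfl⟩ := HomotopyCategory.quotient_obj_surjective X
  obtain ⟨Y, rfl⟩ := HomotopyCategory.quotient_obj_surjective Y
  obtain ⟨f, rfl⟩ := (HomotopyCategory.quotient _ _).map_surjective f
  have h := ((HomotopyCategory.quotient (Proj Rᵐᵒᵖ) (.up ℤ)).commShiftIso (1 : ℤ)).inv.naturality f
  have h1 := congrArg (sdm R) h
  have h2 := comm_sdm R (f⟦(1 : ℤ)⟧')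
  have h3 := congrArg (HomotopyCategory.quotient _ _).map (shiftIsoC_naturality R f)
  rw [Functor.map_comp, Functor.map_comp] at h3
  rw [sdm_comp, sdm_comp] at h1
  exact aux₁ h3 h2 h1

/-- The dual of a short complex of complexes. -/
noncomputable def splitDual (S : ShortComplex (CochainComplex (Proj Rᵐᵒᵖ) ℤ)) :
    ShortComplex (CochainComplex (Proj R) ℤ) :=
  ShortComplex.mk ((dualComplex R).map S.g.op) ((dualComplex R).map S.f.op) (by
    rw [← Functor.map_comp, ← op_comp, S.zero]
    ext i : 1
    exact (dual R).map_zero _ _)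

/-- The dual of a degreewise splitting. -/
noncomputable def splitDualSplitting (S : ShortComplex (CochainComplex (Proj Rᵐᵒᵖ) ℤ))
    (σ : ∀ n, (S.map (HomologicalComplex.eval _ _ n)).Splitting) (n : ℤ) :
    ((splitDual R S).map (HomologicalComplex.eval _ _ n)).Splitting where
  r := (dual R).map (σ (-n)).s.op
  s := (dual R).map (σ (-n)).r.op
  f_r := by
    refine ((dual R).map_comp _ _).symm.trans ?_
    refine Eq.trans ?_ ((dual R).map_id _)
    exact congrArg _ (congrArg Quiver.Hom.op (σ (-n)).s_g)
  s_g := by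
    refine ((dual R).map_comp _ _).symm.trans ?_
    refine Eq.trans ?_ ((dual R).map_id _)
    exact congrArg _ (congrArg Quiver.Hom.op (σ (-n)).f_r)
  id := by
    have := (σ (-n)).id
    have := congrArg (fun f => (dual R).map f.op) this
    simp only [op_add, op_comp, Functor.map_add, Functor.map_comp, op_id] at this
    rw [add_comm] at this
    exact this

lemma split_hom (S : ShortComplex (CochainComplex (Proj Rᵐᵒᵖ) ℤ))
    (σ : ∀ n, (S.map (HomologicalComplex.eval _ _ n)).Splitting) :
    CochainComplex.homOfDegreewiseSplit (splitDual R S) (splitDualSplitting R S σ) =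
    (shiftIsoC R S.X₁).hom ≫
      ((dualComplex R).map (CochainComplex.homOfDegreewiseSplit S σ).op)⟦(1 : ℤ)⟧' := by
  ext i : 1
  rw [CochainComplex.homOfDegreewiseSplit_f]
  change (dual R).map (σ (-i)).r.op ≫ (dual R).map (S.X₂.d (-(i + 1)) (-i)).op ≫
    (dual R).map (σ (-(i + 1))).s.op = (dual R).map (S.X₁.XIsoOfEq _).hom.op ≫
      (dual R).map ((CochainComplex.homOfDegreewiseSplit S σ).f (-(i + 1))).op
  rw [CochainComplex.homOfDegreewiseSplit_f]
  change _ = _ ≫ (dual R).map ((σ (-(i + 1))).s ≫ S.X₂.d (-(i + 1)) (-(i + 1) + 1) ≫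
    (σ (-(i + 1) + 1)).r).op
  have key : ∀ (a b c : ℤ) (h : a = b), (σ c).s ≫ S.X₂.d c b ≫ (σ b).r =
      ((σ c).s ≫ S.X₂.d c a ≫ (σ a).r) ≫ (S.X₁.XIsoOfEq h).hom := by
    rintro a b c rfl
    exact (Category.comp_id _).symm
  have := congrArg (fun f => (dual R).map f.op)
    (key (-(i + 1) + 1) (-i) (-(i + 1)) (by lia))
  refine Eq.trans ?_ (this.trans ((dual R).map_comp _ _))
  refine (congrArg (_ ≫ ·) ((dual R).map_comp _ _).symm).trans ?_
  refine ((dual R).map_comp _ _).symm.trans ?_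
  exact congrArg (fun f => (dual R).map f.op) (Category.assoc _ _ _)

lemma dualTriangle_split (S : ShortComplex (CochainComplex (Proj Rᵐᵒᵖ) ℤ))
    (σ : ∀ n, (S.map (HomologicalComplex.eval _ _ n)).Splitting) :
    Nonempty (dualTriangle R (CochainComplex.trianglehOfDegreewiseSplit S σ) ≅
      CochainComplex.trianglehOfDegreewiseSplit (splitDual R S) (splitDualSplitting R S σ)) := by
  refine ⟨Triangle.isoMk _ _ (Iso.refl _) (Iso.refl _) (Iso.refl _) ?_ ?_ ?_⟩
  · exact (Category.comp_id _).trans (Category.id_comp _).symm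
  · exact (Category.comp_id _).trans (Category.id_comp _).symm
  · refine Eq.trans ?_ (Category.id_comp _).symm
    refine (congrArg (_ ≫ ·) (CategoryTheory.Functor.map_id _ _)).trans ((Category.comp_id _).trans ?_)
    change (shiftIso R _).hom ≫ sdm R ((HomotopyCategory.quotient _ _).map
      (CochainComplex.homOfDegreewiseSplit S σ) ≫
        ((HomotopyCategory.quotient _ _).commShiftIso (1 : ℤ)).hom.app _) =
      (HomotopyCategory.quotient _ _).map
        (CochainComplex.homOfDegreewiseSplit (splitDual R S) (splitDualSplitting R S σ)) ≫
          ((HomotopyCategory.quotient _ _).commShiftIso (1 : ℤ)).hom.app _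
    have h := congrArg (sdm R) (((HomotopyCategory.quotient (Proj Rᵐᵒᵖ) (.up ℤ)).commShiftIso
      (1 : ℤ)).hom_inv_id_app S.X₁)
    have h1 := (sdm_comp R _ _).symm.trans (h.trans (sdm_id R _))
    have h2 := comm_sdm R (CochainComplex.homOfDegreewiseSplit S σ)
    have h3 := congrArg (HomotopyCategory.quotient _ _).map (split_hom R S σ)
    exact aux₂ (sdm_comp R _ _) h1 h2 (h3.trans ((HomotopyCategory.quotient _ _).map_comp _ _))

/-- The dual triangle of a distinguished triangle is distinguished. -/
theorem dualTriangle_distinguished (T : Triangle (KProj Rᵐᵒᵖ)) (hT : T ∈ distTriang _) :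
    dualTriangle R T ∈ distTriang _ := by
  obtain ⟨S, σ, ⟨e⟩⟩ := (HomotopyCategory.distinguished_iff_iso_trianglehOfDegreewiseSplit T).1 hT
  obtain ⟨e'⟩ := dualTriangle_split R S σ
  refine (HomotopyCategory.distinguished_iff_iso_trianglehOfDegreewiseSplit _).2
    ⟨_, _, ⟨?_ ≪≫ e'⟩⟩
  refine Triangle.isoMk _ _ ((dualK R).mapIso ((Triangle.π₃.mapIso e).op.symm))
    ((dualK R).mapIso ((Triangle.π₂.mapIso e).op.symm))
    ((dualK R).mapIso ((Triangle.π₁.mapIso e).op.symm)) ?_ ?_ ?_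
  · have := congrArg (fun f => (dualK R).map f.op) e.inv.comm₂
    simp only [op_comp, Functor.map_comp] at this
    exact this.symm
  · have := congrArg (fun f => (dualK R).map f.op) e.inv.comm₁
    simp only [op_comp, Functor.map_comp] at this
    exact this.symm
  · have h := shiftIso_naturality R e.inv.hom₁
    have h3 := congrArg (sdm R) e.inv.comm₃
    rw [sdm_comp, sdm_comp] at h3
    change ((shiftIso R _).hom ≫ sdm R _) ≫ sdm R _ =
      (dualK R).map e.inv.hom₁.op ≫ (shiftIso R _).hom ≫ sdm R _
    exact aux₃ h h3

end dual

/-- An object `X` of `K(proj R)` (complexes of right `R`-modules) is `n`-torsionfree if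
`Ext^j(C^i(X^*), R) = 0` for all integers `i` and all `1 ≤ j ≤ n`; here `X^*` is a complex of left
`R`-modules, and `Ext` is taken over left `R`-modules. -/
def IsTorsionfree {R : Type u} [Ring R] (n : ℕ) (X : KProj Rᵐᵒᵖ) : Prop :=
  ∀ (i : ℤ) (j : ℕ), 1 ≤ j → j ≤ n →
    Subsingleton (Abelian.Ext (cokernelModule ((dualK R).obj (op X)) i) (ModuleCat.of R R) j)

end StableComplex

/-! Both directions rest on dimension shifting: if `X ⟶ P ⟶ X'` is a cohomologically ghost triangle
with ghost dual and `P` in `Add R`, then `X` is `(n+1)`-torsionfree iff `X'` is `n`-torsionfree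
(`isTorsionfree_succ_iff`).

Represent the triangle by a degreewise split sequence of complexes. Its dual is surjective on
cohomology, so `0 ⟶ C^i(X'^*) ⟶ C^i(P^*) ⟶ C^i(X^*) ⟶ 0` is exact (`shortExact_opcycles`). The
middle term has no higher Ext: `P` is a retract of a complex of free modules with zero differential
(`exists_retract_freeComplex`), and homotopy changes `C^i` only up to projectives. So
`Ext^{j+1}(C^i(X^*), R)` vanishes iff `Ext^j(C^i(X'^*), R)` does, for `j ≥ 1`. By reflexivity of
finitely generated projectives, a form on `C^i(X'^*)` is a cycle of `X'` in degree `-i`; such cycles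
lift to `P` because the original triangle is ghost. Hence `Ext^1(C^i(X^*), R) = 0`
(`ext_one_of_ghost`).

Conversely, a 1-torsionfree `X` starts such a triangle (`exists_ghost_triangle`): finitely many
generators of the cycles of `X^*` in each degree define `X ⟶ P` with `P` free with zero
differential. The dual map is onto on cohomology by construction, and `X ⟶ P` is injective on
cohomology because `Ext^1(C^i(X^*), R) = 0`. Induction on `n` finishes both directions. -/

namespace StableComplex

/-! ### Cohomology and cokernels of differentials, in terms of elements. -/

section ModuleComplexes

variable {A : Type u} [Ring A] {K L : CochainComplex (ModuleCat.{u} A) ℤ}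

lemma exists_iCycles_eq {i j : ℤ} (hij : i + 1 = j) (x : K.X i) (hx : K.d i j x = 0) :
    ∃ c : K.cycles i, K.iCycles i c = x := by
  obtain rfl : (ComplexShape.up ℤ).next i = j := by simp [hij]
  exact ((ShortComplex.moduleCat_exact_iff _).1 (ShortComplex.exact_of_f_is_kernel
    (ShortComplex.mk (K.iCycles i) (K.d i _) (by simp)) (K.cyclesIsKernel i _ rfl))) x hx

lemma homologyπ_eq_zero_iff {k i : ℤ} (hki : k + 1 = i) (c : K.cycles i) :
    K.homologyπ i c = 0 ↔ ∃ w : K.X k, K.d k i w = K.iCycles i c := by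
  obtain rfl : (ComplexShape.up ℤ).prev i = k := by simp [← hki]
  have hc : K.homologyπ i c = 0 ↔ ∃ w, K.toCycles ((ComplexShape.up ℤ).prev i) i w = c := by
    constructor
    · exact ((ShortComplex.moduleCat_exact_iff _).1 (ShortComplex.exact_of_g_is_cokernel
        (ShortComplex.mk (K.toCycles _ i) (K.homologyπ i) (by simp))
          (K.homologyIsCokernel _ i rfl))) c
    · rintro ⟨w, rfl⟩
      rw [← ModuleCat.comp_apply, HomologicalComplex.toCycles_comp_homologyπ]
      rfl
  rw [hc]
  refine exists_congr fun w => ?_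
  rw [← K.toCycles_i (ComplexShape.prev _ i) i, ModuleCat.comp_apply]
  exact ((ModuleCat.mono_iff_injective (K.iCycles i)).1 inferInstance).eq_iff.symm

lemma homologyπ_surjective (i : ℤ) : Function.Surjective (K.homologyπ i) :=
  (ModuleCat.epi_iff_surjective _).1 inferInstance

lemma d_iCycles {i j : ℤ} (c : K.cycles i) : K.d i j (K.iCycles i c) = 0 := by
  rw [← ModuleCat.comp_apply, HomologicalComplex.iCycles_d]
  rfl

lemma homologyMap_homologyπ (φ : K ⟶ L) (i : ℤ) (c : K.cycles i) :
    HomologicalComplex.homologyMap φ i (K.homologyπ i c) =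
      L.homologyπ i (HomologicalComplex.cyclesMap φ i c) := by
  rw [← ModuleCat.comp_apply, HomologicalComplex.homologyπ_naturality, ModuleCat.comp_apply]

lemma iCycles_cyclesMap (φ : K ⟶ L) (i : ℤ) (c : K.cycles i) :
    L.iCycles i (HomologicalComplex.cyclesMap φ i c) = φ.f i (K.iCycles i c) := by
  rw [← ModuleCat.comp_apply, HomologicalComplex.cyclesMap_i, ModuleCat.comp_apply]

lemma homologyMap_eq_zero_iff (φ : K ⟶ L) {k i j : ℤ} (hk : k + 1 = i) (hj : i + 1 = j) :
    HomologicalComplex.homologyMap φ i = 0 ↔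
      ∀ z : K.X i, K.d i j z = 0 → ∃ w : L.X k, L.d k i w = φ.f i z := by
  constructor
  · intro h z hz
    obtain ⟨c, rfl⟩ := exists_iCycles_eq hj z hz
    rw [← iCycles_cyclesMap, ← homologyπ_eq_zero_iff hk, ← homologyMap_homologyπ, h]
    rfl
  · intro h
    ext x
    obtain ⟨c, rfl⟩ := homologyπ_surjective i x
    rw [homologyMap_homologyπ]
    refine (homologyπ_eq_zero_iff hk _).2 ?_
    rw [iCycles_cyclesMap]
    exact h _ (d_iCycles c)

lemma mono_homologyMap_iff (φ : K ⟶ L) {k i j : ℤ} (hk : k + 1 = i) (hj : i + 1 = j) :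
    Mono (HomologicalComplex.homologyMap φ i) ↔
      ∀ z : K.X i, K.d i j z = 0 → ∀ w : L.X k, L.d k i w = φ.f i z →
        ∃ v : K.X k, K.d k i v = z := by
  rw [ModuleCat.mono_iff_injective, injective_iff_map_eq_zero]
  constructor
  · intro h z hz w hw
    obtain ⟨c, rfl⟩ := exists_iCycles_eq hj z hz
    refine (homologyπ_eq_zero_iff hk _).1 (h _ ?_)
    rw [homologyMap_homologyπ, homologyπ_eq_zero_iff hk, iCycles_cyclesMap]
    exact ⟨w, hw⟩
  · intro h x hx
    obtain ⟨c, rfl⟩ := homologyπ_surjective i x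
    rw [homologyMap_homologyπ, homologyπ_eq_zero_iff hk, iCycles_cyclesMap] at hx
    obtain ⟨w, hw⟩ := hx
    exact (homologyπ_eq_zero_iff hk _).2 (h _ (d_iCycles c) w hw)

lemma epi_homologyMap_iff (φ : K ⟶ L) {k i j : ℤ} (hk : k + 1 = i) (hj : i + 1 = j) :
    Epi (HomologicalComplex.homologyMap φ i) ↔
      ∀ z : L.X i, L.d i j z = 0 →
        ∃ (y : K.X i) (w : L.X k), K.d i j y = 0 ∧ φ.f i y + L.d k i w = z := by
  rw [ModuleCat.epi_iff_surjective]
  constructor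
  · intro h z hz
    obtain ⟨c, rfl⟩ := exists_iCycles_eq hj z hz
    obtain ⟨x, hx⟩ := h (L.homologyπ i c)
    obtain ⟨b, rfl⟩ := homologyπ_surjective i x
    rw [homologyMap_homologyπ, eq_comm, ← sub_eq_zero, ← map_sub,
      homologyπ_eq_zero_iff hk, map_sub, iCycles_cyclesMap] at hx
    obtain ⟨w, hw⟩ := hx
    exact ⟨_, w, d_iCycles b, by rw [hw]; abel⟩
  · intro h x
    obtain ⟨c, rfl⟩ := homologyπ_surjective i x
    obtain ⟨y, w, hy, hw⟩ := h _ (d_iCycles c)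
    obtain ⟨b, rfl⟩ := exists_iCycles_eq hj y hy
    refine ⟨K.homologyπ i b, ?_⟩
    rw [homologyMap_homologyπ, eq_comm, ← sub_eq_zero, ← map_sub,
      homologyπ_eq_zero_iff hk, map_sub, iCycles_cyclesMap]
    exact ⟨w, by rw [← hw]; abel⟩

lemma pOpcycles_surjective (i : ℤ) : Function.Surjective (K.pOpcycles i) :=
  (ModuleCat.epi_iff_surjective _).1 inferInstance

lemma pOpcycles_eq_zero_iff {k i : ℤ} (hki : k + 1 = i) (x : K.X i) :
    K.pOpcycles i x = 0 ↔ ∃ w : K.X k, K.d k i w = x := by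
  obtain rfl : (ComplexShape.up ℤ).prev i = k := by simp [← hki]
  constructor
  · exact ((ShortComplex.moduleCat_exact_iff _).1 (ShortComplex.exact_of_g_is_cokernel
      (ShortComplex.mk (K.d _ i) (K.pOpcycles i) (by simp)) (K.opcyclesIsCokernel _ i rfl))) x
  · rintro ⟨w, rfl⟩
    rw [← ModuleCat.comp_apply, HomologicalComplex.d_pOpcycles]
    rfl

lemma opcyclesMap_pOpcycles (φ : K ⟶ L) (i : ℤ) (x : K.X i) :
    HomologicalComplex.opcyclesMap φ i (K.pOpcycles i x) = L.pOpcycles i (φ.f i x) := by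
  rw [← ModuleCat.comp_apply, HomologicalComplex.p_opcyclesMap, ModuleCat.comp_apply]

/-- If a short exact sequence of complexes is surjective on cohomology, then the sequence of
cokernels of the differentials is short exact. -/
lemma shortExact_opcycles (S : ShortComplex (CochainComplex (ModuleCat.{u} A) ℤ))
    (hS : ∀ i, (S.map (HomologicalComplex.eval _ _ i)).ShortExact)
    (h : ∀ i, Epi (HomologicalComplex.homologyMap S.g i)) (i : ℤ) :
    (ShortComplex.mk (HomologicalComplex.opcyclesMap S.f i) (HomologicalComplex.opcyclesMap S.g i)
      (by rw [← HomologicalComplex.opcyclesMap_comp, S.zero,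
        HomologicalComplex.opcyclesMap_zero])).ShortExact := by
  have inj (k : ℤ) : Function.Injective (S.f.f k) := (hS k).moduleCat_injective_f
  have surj (k : ℤ) : Function.Surjective (S.g.f k) := (hS k).moduleCat_surjective_g
  have exact (k : ℤ) (x : S.X₂.X k) (hx : S.g.f k x = 0) : ∃ y, S.f.f k y = x :=
    (ShortComplex.moduleCat_exact_iff _).1 (hS k).exact x hx
  have zero (k : ℤ) (x : S.X₁.X k) : S.g.f k (S.f.f k x) = 0 :=
    (S.map (HomologicalComplex.eval _ _ k)).moduleCat_zero_apply x
  have comm {M N : CochainComplex (ModuleCat.{u} A) ℤ} (φ : M ⟶ N) (k l : ℤ) (x : M.X k) :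
      N.d k l (φ.f k x) = φ.f l (M.d k l x) := by
    rw [← ModuleCat.comp_apply, φ.comm, ModuleCat.comp_apply]
  have hk : (i - 1) + 1 = i := by lia
  have hl : (i - 1 - 1) + 1 = i - 1 := by lia
  refine ShortComplex.ShortExact.mk' ?_ ?_ ?_
  · rw [ShortComplex.moduleCat_exact_iff]
    intro x hx
    obtain ⟨x, rfl⟩ := pOpcycles_surjective i x
    dsimp at x hx ⊢
    rw [opcyclesMap_pOpcycles, pOpcycles_eq_zero_iff hk] at hx
    obtain ⟨w, hw⟩ := hx
    obtain ⟨v, rfl⟩ := surj _ w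
    obtain ⟨y, hy⟩ := exact i (x - S.X₂.d _ _ v) (by rw [map_sub, ← comm, hw, sub_self])
    refine ⟨S.X₁.pOpcycles i y, ?_⟩
    rw [opcyclesMap_pOpcycles, hy, map_sub, (pOpcycles_eq_zero_iff hk _).2 ⟨v, rfl⟩, sub_zero]
  · rw [ModuleCat.mono_iff_injective, injective_iff_map_eq_zero]
    intro x hx
    obtain ⟨x, rfl⟩ := pOpcycles_surjective i x
    dsimp at x hx ⊢
    rw [opcyclesMap_pOpcycles, pOpcycles_eq_zero_iff hk] at hx
    obtain ⟨p, hp⟩ := hx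
    -- Here `f x = d p`, so `g p` is a cycle. Writing it as `g y` plus a boundary corrects `p` by a
    -- cycle and a boundary into the image of `f`, without changing `d p`.
    obtain ⟨y, w, hy, hw⟩ := (epi_homologyMap_iff S.g hl hk).1 (h _) (S.g.f _ p) (by
      rw [comm, hp, zero])
    obtain ⟨v, rfl⟩ := surj _ w
    obtain ⟨t, ht⟩ := exact _ (p - y - S.X₂.d _ _ v) (by
      rw [map_sub, map_sub, ← hw, comm]; abel)
    refine (pOpcycles_eq_zero_iff hk _).2 ⟨t, inj _ ?_⟩
    have hd : S.X₂.d (i - 1) i (S.X₂.d (i - 1 - 1) (i - 1) v) = 0 := by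
      rw [← ModuleCat.comp_apply, HomologicalComplex.d_comp_d]; rfl
    rw [← comm, ht, map_sub, map_sub, hy, hd, hp]
    abel
  · rw [ModuleCat.epi_iff_surjective]
    intro x
    obtain ⟨x, rfl⟩ := pOpcycles_surjective i x
    obtain ⟨y, rfl⟩ := surj _ x
    exact ⟨S.X₂.pOpcycles i y, opcyclesMap_pOpcycles _ _ _⟩

end ModuleComplexes

/-! ### Vanishing of Ext and dimension shifting. -/

section ExtVanishing

universe v w
variable {C : Type v} [Category.{u} C] [Abelian C] [HasExt.{w} C]

open Abelian

/-- `Ext^j(M, N) = 0` for all `j ≥ 1`. -/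
def ExtAcyclic (N M : C) : Prop := ∀ j : ℕ, 1 ≤ j → Subsingleton (Ext M N j)

lemma extAcyclic_of_projective (N M : C) [Projective M] : ExtAcyclic N M := by
  intro j hj
  obtain ⟨k, rfl⟩ : ∃ k, j = k + 1 := ⟨j - 1, by lia⟩
  exact ⟨fun a b => (Ext.eq_zero_of_projective a).trans (Ext.eq_zero_of_projective b).symm⟩

/-- If `𝟙 M` is the sum of a morphism through `M'` and of a morphism through a projective object,
then the vanishing of `Ext^j(M', N)` implies that of `Ext^j(M, N)`, for `j ≥ 1`. -/
lemma ext_subsingleton_of_id_eq_add {N M M' Q : C} [Projective Q] {j : ℕ} (hj : 1 ≤ j)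
    [Subsingleton (Ext M' N j)] (a : M ⟶ M') (b : M' ⟶ M) (p : M ⟶ Q) (q : Q ⟶ M)
    (hab : 𝟙 M = a ≫ b + p ≫ q) : Subsingleton (Ext M N j) := by
  have := extAcyclic_of_projective N Q j hj
  have key (x : Ext M N j) : x = 0 := by
    rw [← Ext.mk₀_id_comp x, hab, Ext.mk₀_add, Ext.add_comp, ← Ext.mk₀_comp_mk₀,
      ← Ext.mk₀_comp_mk₀, Ext.comp_assoc_of_second_deg_zero, Ext.comp_assoc_of_second_deg_zero,
      Subsingleton.elim ((Ext.mk₀ b).comp x (zero_add j)) 0,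
      Subsingleton.elim ((Ext.mk₀ q).comp x (zero_add j)) 0, Ext.comp_zero, Ext.comp_zero, add_zero]
  exact ⟨fun x y => (key x).trans (key y).symm⟩

variable {S : ShortComplex C} {N : C}

lemma ext_succ_iff (hS : S.ShortExact) (h : ExtAcyclic N S.X₂) {j : ℕ} (hj : 1 ≤ j) :
    Subsingleton (Ext S.X₃ N (j + 1)) ↔ Subsingleton (Ext S.X₁ N j) := by
  have h₂ := h j hj
  have h₂' := h (j + 1) (by lia)
  constructor
  · intro h₃
    have key (x : Ext S.X₁ N j) : x = 0 := by
      obtain ⟨y, rfl⟩ := Ext.contravariant_sequence_exact₁ hS N x (add_comm 1 j)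
        (Subsingleton.elim _ _)
      rw [Subsingleton.elim y 0, Ext.comp_zero]
    exact ⟨fun x y => (key x).trans (key y).symm⟩
  · intro h₁
    have key (x : Ext S.X₃ N (j + 1)) : x = 0 := by
      obtain ⟨y, rfl⟩ := Ext.contravariant_sequence_exact₃ hS N x (Subsingleton.elim _ _)
        (add_comm 1 j)
      rw [Subsingleton.elim y 0, Ext.comp_zero]
    exact ⟨fun x y => (key x).trans (key y).symm⟩

/-- Since `Ext^1(X₂, N) = 0`, every class comes from a morphism `X₁ ⟶ N` by the connecting map,
which kills the morphisms that extend to `X₂`. -/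
lemma ext_one_of_forall_exists (hS : S.ShortExact) (h : ExtAcyclic N S.X₂)
    (hf : ∀ a : S.X₁ ⟶ N, ∃ b : S.X₂ ⟶ N, S.f ≫ b = a) : Subsingleton (Ext S.X₃ N 1) := by
  have h₂ := h 1 le_rfl
  have key (x : Ext S.X₃ N 1) : x = 0 := by
    obtain ⟨y, rfl⟩ := Ext.contravariant_sequence_exact₃ hS N x (Subsingleton.elim _ _)
      (add_zero 1)
    obtain ⟨a, rfl⟩ := Ext.homEquiv₀.symm.surjective y
    obtain ⟨b, rfl⟩ := hf a
    change hS.extClass.comp (Ext.mk₀ (S.f ≫ b)) _ = 0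
    rw [← Ext.mk₀_comp_mk₀, hS.extClass_comp_assoc]
  exact ⟨fun x y => (key x).trans (key y).symm⟩

lemma exists_of_ext_one (hS : S.ShortExact) [Subsingleton (Ext S.X₃ N 1)] (a : S.X₁ ⟶ N) :
    ∃ b : S.X₂ ⟶ N, S.f ≫ b = a := by
  obtain ⟨y, hy⟩ := Ext.contravariant_sequence_exact₁ hS N (Ext.mk₀ a) (add_zero 1)
    (Subsingleton.elim _ _)
  obtain ⟨b, rfl⟩ := Ext.homEquiv₀.symm.surjective y
  refine ⟨b, Ext.homEquiv₀.symm.injective ?_⟩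
  change (Ext.mk₀ S.f).comp (Ext.mk₀ b) _ = _ at hy
  rw [Ext.mk₀_comp_mk₀] at hy
  exact hy

end ExtVanishing

/-- If `Ext¹(C^j(K), N) = 0`, then every linear form on `K^i` which vanishes on the cycles factors
through the differential `K^i ⟶ K^j`, where `j = i + 1`. -/
lemma exists_d_comp_eq {A : Type u} [Ring A] (K : CochainComplex (ModuleCat.{u} A) ℤ)
    (N : ModuleCat.{u} A) {i j : ℤ} (hij : i + 1 = j) [Projective (K.X j)]
    [Subsingleton (Abelian.Ext (K.opcycles j) N 1)] (f : K.X i →ₗ[A] N)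
    (hf : ∀ x, K.d i j x = 0 → f x = 0) :
    ∃ g : K.X j →ₗ[A] N, ∀ x, g (K.d i j x) = f x := by
  let d : K.X i →ₗ[A] K.X j := (K.d i j).hom
  let S : ShortComplex (ModuleCat.{u} A) :=
    ShortComplex.mk (ModuleCat.ofHom (LinearMap.range d).subtype) (K.pOpcycles j) (by
      ext ⟨_, w, rfl⟩
      exact (pOpcycles_eq_zero_iff hij _).2 ⟨w, rfl⟩)
  have hS : S.ShortExact := by
    refine ShortComplex.ShortExact.mk' ?_ ?_ ?_
    · rw [ShortComplex.moduleCat_exact_iff]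
      intro x hx
      obtain ⟨w, hw⟩ := (pOpcycles_eq_zero_iff hij _).1 hx
      exact ⟨⟨x, w, hw⟩, rfl⟩
    · exact (ModuleCat.mono_iff_injective _).2 Subtype.val_injective
    · exact inferInstanceAs (Epi (K.pOpcycles j))
  have : Subsingleton (Abelian.Ext S.X₃ N 1) :=
    inferInstanceAs (Subsingleton (Abelian.Ext (K.opcycles j) N 1))
  have hf' : LinearMap.ker d ≤ LinearMap.ker f := hf
  -- The form descends to the image of `d`, since it kills the kernel; the vanishing of `Ext^1`
  -- extends it to `K^j`.
  obtain ⟨b, hb⟩ := exists_of_ext_one hS (ModuleCat.ofHom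
    (((LinearMap.ker d).liftQ f hf').comp d.quotKerEquivRange.symm.toLinearMap))
  refine ⟨b.hom, fun x => ?_⟩
  refine (ConcreteCategory.congr_hom hb ⟨d x, x, rfl⟩).trans ?_
  have hx : d.quotKerEquivRange.symm ⟨d x, x, rfl⟩ = (LinearMap.ker d).mkQ x :=
    d.quotKerEquivRange_symm_apply_image x ⟨x, rfl⟩
  change ((LinearMap.ker d).liftQ f hf') (d.quotKerEquivRange.symm ⟨d x, x, rfl⟩) = _
  rw [hx]
  rfl

/-! ### Cohomology on the homotopy category and criteria for ghost triangles. -/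

section Cohomology

variable {A : Type u} [Ring A]

/-- The complex of modules underlying a complex of finitely generated projective modules. -/
noncomputable abbrev toModules (A : Type u) [Ring A] :
    CochainComplex (Proj A) ℤ ⥤ CochainComplex (ModuleCat.{u} A) ℤ :=
  (fgProjective A).ι.mapHomologicalComplex (ComplexShape.up ℤ)

/-- The projection functor to the homotopy category. -/
abbrev toKProj (A : Type u) [Ring A] : CochainComplex (Proj A) ℤ ⥤ KProj A :=
  HomotopyCategory.quotient (Proj A) (ComplexShape.up ℤ)

/-- The cohomology of an object of the homotopy category is that of the underlying complex. -/
noncomputable def cohomologyIso (i : ℤ) : toKProj A ⋙ cohomology A i ≅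
    toModules A ⋙ HomologicalComplex.homologyFunctor (ModuleCat.{u} A) (ComplexShape.up ℤ) i :=
  Functor.isoWhiskerLeft (toModules A)
    (HomotopyCategory.homologyFunctorFactors (ModuleCat.{u} A) (ComplexShape.up ℤ) i)

variable {K L : CochainComplex (Proj A) ℤ} (φ : K ⟶ L) (i : ℤ)

lemma epi_cohomology_map_iff : Epi ((cohomology A i).map ((toKProj A).map φ)) ↔
    Epi (HomologicalComplex.homologyMap ((toModules A).map φ) i) :=
  (MorphismProperty.epimorphisms _).arrow_mk_iso_iff
    ((Functor.mapArrowFunctor _ _ |>.mapIso (cohomologyIso i)).app (Arrow.mk φ))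

lemma mono_cohomology_map_iff : Mono ((cohomology A i).map ((toKProj A).map φ)) ↔
    Mono (HomologicalComplex.homologyMap ((toModules A).map φ) i) :=
  (MorphismProperty.monomorphisms _).arrow_mk_iso_iff
    ((Functor.mapArrowFunctor _ _ |>.mapIso (cohomologyIso i)).app (Arrow.mk φ))

lemma cohomology_map_eq_zero_iff : (cohomology A i).map ((toKProj A).map φ) = 0 ↔
    HomologicalComplex.homologyMap ((toModules A).map φ) i = 0 := by
  have h := NatIso.naturality_2 (cohomologyIso (A := A) i) φ
  have h' := NatIso.naturality_1 (cohomologyIso (A := A) i) φ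
  constructor
  · intro h₀
    refine h'.symm.trans ((congrArg (_ ≫ · ≫ _) h₀).trans ?_)
    exact (congrArg (_ ≫ ·) zero_comp).trans comp_zero
  · intro h₀
    refine h.symm.trans ((congrArg (_ ≫ · ≫ _) h₀).trans ?_)
    exact (congrArg (_ ≫ ·) zero_comp).trans comp_zero

noncomputable instance : (cohomology A 0).ShiftSequence ℤ :=
  inferInstanceAs (((fgProjective A).ι.mapHomotopyCategory (ComplexShape.up ℤ) ⋙
    HomotopyCategory.homologyFunctor (ModuleCat.{u} A) (ComplexShape.up ℤ) 0).ShiftSequence ℤ)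

instance : (cohomology A 0).IsHomological :=
  inferInstanceAs (((fgProjective A).ι.mapHomotopyCategory (ComplexShape.up ℤ) ⋙
    HomotopyCategory.homologyFunctor (ModuleCat.{u} A) (ComplexShape.up ℤ) 0).IsHomological)

instance : (cohomology A i).Additive :=
  inferInstanceAs (((fgProjective A).ι.mapHomotopyCategory (ComplexShape.up ℤ) ⋙
    HomotopyCategory.homologyFunctor (ModuleCat.{u} A) (ComplexShape.up ℤ) i).Additive)

variable {T : Triangle (KProj A)}

/-- Each side says that the connecting map from degree `i` to degree `i + 1` is zero. -/
lemma epi_iff_mono_succ (hT : T ∈ distTriang (KProj A)) :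
    Epi ((cohomology A i).map T.mor₂) ↔ Mono ((cohomology A (i + 1)).map T.mor₁) :=
  ((cohomology A 0).homologySequence_epi_shift_map_mor₂_iff T hT i (i + 1) rfl).trans
    ((cohomology A 0).homologySequence_mono_shift_map_mor₁_iff T hT i (i + 1) rfl).symm

lemma epi_mor₁_iff (hT : T ∈ distTriang (KProj A)) :
    Epi ((cohomology A i).map T.mor₁) ↔ (cohomology A i).map T.mor₂ = 0 :=
  (cohomology A 0).homologySequence_epi_shift_map_mor₁_iff T hT i

lemma isCohomologicallyGhost_of_epi (hT : T ∈ distTriang (KProj A))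
    (h : ∀ i, Epi ((cohomology A i).map T.mor₂)) :
    IsCohomologicallyGhost T where
  distinguished := hT
  shortExact i :=
    ⟨(cohomology A 0).homologySequence_comp T hT i,
      { exact := (cohomology A 0).homologySequence_exact₂ T hT i
        mono_f := by
          have := (epi_iff_mono_succ (i - 1) hT).1 (h (i - 1))
          rwa [sub_add_cancel] at this
        epi_g := h i }⟩

lemma isCohomologicallyGhost_of_mono (hT : T ∈ distTriang (KProj A))
    (h : ∀ i, Mono ((cohomology A i).map T.mor₁)) :
    IsCohomologicallyGhost T :=
  isCohomologicallyGhost_of_epi hT fun i => (epi_iff_mono_succ i hT).2 (h _)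

end Cohomology

/-! ### Homotopy invariance of the vanishing of Ext. -/

section Retracts

variable {A : Type u} [Ring A]

instance (K : CochainComplex (Proj A) ℤ) (i : ℤ) : Projective (((toModules A).obj K).X i) :=
  (IsProjective.iff_projective _).1 (K.X i).property.2

/-- `C^i` is not a functor on the homotopy category. In a homotopy from `f ≫ g` to the identity,
however, the term ending with the differential dies in the cokernel, and the other one factors
through the projective module `Y^{i+1}`. -/
lemma ext_cokernelModule_of_retract {Y Z : KProj A} (r : Retract Y Z) (N : ModuleCat.{u} A) (i : ℤ)
    {j : ℕ} (hj : 1 ≤ j) (h : Subsingleton (Abelian.Ext (cokernelModule Z i) N j)) :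
    Subsingleton (Abelian.Ext (cokernelModule Y i) N j) := by
  obtain ⟨Y, rfl⟩ := HomotopyCategory.quotient_obj_surjective Y
  obtain ⟨Z, rfl⟩ := HomotopyCategory.quotient_obj_surjective Z
  obtain ⟨f, hf⟩ := (toKProj A).map_surjective r.i
  obtain ⟨g, hg⟩ := (toKProj A).map_surjective r.r
  have H : Homotopy (f ≫ g) (𝟙 Y) := HomotopyCategory.homotopyOfEq _ _ (by
    rw [Functor.map_comp, hf, hg, r.retract, CategoryTheory.Functor.map_id])
  let H' := (fgProjective A).ι.mapHomotopy H
  let Y' := (toModules A).obj Y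
  have hc := H'.comm i
  rw [dNext_eq H'.hom (show (ComplexShape.up ℤ).Rel i (i + 1) from rfl),
    prevD_eq H'.hom (show (ComplexShape.up ℤ).Rel (i - 1) i by simp)] at hc
  have : Subsingleton (Abelian.Ext (((toModules A).obj Z).opcycles i) N j) := h
  refine ext_subsingleton_of_id_eq_add (M := Y'.opcycles i) (Q := Y'.X (i + 1)) hj
    (HomologicalComplex.opcyclesMap ((toModules A).map f) i)
    (HomologicalComplex.opcyclesMap ((toModules A).map g) i)
    (Y'.fromOpcycles i (i + 1)) (-(H'.hom (i + 1) i ≫ Y'.pOpcycles i)) ?_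
  rw [← cancel_epi (Y'.pOpcycles i)]
  have e₁ : Y'.pOpcycles i ≫ HomologicalComplex.opcyclesMap ((toModules A).map f) i ≫
      HomologicalComplex.opcyclesMap ((toModules A).map g) i =
      ((toModules A).map (f ≫ g)).f i ≫ Y'.pOpcycles i := by
    rw [HomologicalComplex.p_opcyclesMap_assoc, HomologicalComplex.p_opcyclesMap, Functor.map_comp,
      HomologicalComplex.comp_f, Category.assoc]
  have e₂ : ((toModules A).map (𝟙 Y)).f i = 𝟙 (Y'.X i) := by rw [CategoryTheory.Functor.map_id]; rfl
  have e₃ : (H'.hom i (i - 1) ≫ Y'.d (i - 1) i) ≫ Y'.pOpcycles i = 0 := by simp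
  rw [Preadditive.comp_add, e₁]
  erw [hc]
  rw [e₂, Preadditive.add_comp, Preadditive.add_comp]
  erw [e₃]
  rw [Preadditive.comp_neg, Preadditive.comp_neg, Y'.p_fromOpcycles_assoc, Category.assoc]
  erw [Category.id_comp, Category.comp_id]
  abel

end Retracts

/-! ### Reflexivity of finitely generated projective modules. -/

section Reflexive

variable {R : Type u} [Ring R] {M : Type u} [AddCommGroup M] [Module Rᵐᵒᵖ M]

/-- Evaluation at an element, as a linear form on the dual module. -/
def evalDual (x : M) : (M →ₗ[Rᵐᵒᵖ] R) →ₗ[R] R where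
  toFun f := f x
  map_add' _ _ := rfl
  map_smul' _ _ := rfl

variable [Module.Finite Rᵐᵒᵖ M] [Module.Projective Rᵐᵒᵖ M]

/-- The dual basis lemma for finitely generated projective right modules. -/
lemma exists_dualBasis (R : Type u) [Ring R] (M : Type u) [AddCommGroup M] [Module Rᵐᵒᵖ M]
    [Module.Finite Rᵐᵒᵖ M] [Module.Projective Rᵐᵒᵖ M] :
    ∃ (n : ℕ) (e : Fin n → M) (c : Fin n → M →ₗ[Rᵐᵒᵖ] R),
      ∀ x, ∑ a, MulOpposite.op (c a x) • e a = x := by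
  obtain ⟨n, f, g, -, -, h⟩ := Module.Finite.exists_comp_eq_id_of_projective Rᵐᵒᵖ M
  let p (a : Fin n) : (Fin n → Rᵐᵒᵖ) →ₗ[Rᵐᵒᵖ] R :=
    { toFun v := (v a).unop, map_add' _ _ := rfl, map_smul' _ _ := rfl }
  refine ⟨n, fun a => f (Pi.single a 1), fun a => p a ∘ₗ g, fun x => ?_⟩
  refine Eq.trans ?_ (LinearMap.congr_fun h x)
  change ∑ a, g x a • f (Pi.single a 1) = f (g x)
  conv_rhs => rw [pi_eq_sum_univ' (g x), map_sum]
  refine Finset.sum_congr rfl fun a _ => ?_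
  rw [← map_smul]

lemma eq_of_forall_dual_eq {x y : M} (h : ∀ f : M →ₗ[Rᵐᵒᵖ] R, f x = f y) : x = y := by
  obtain ⟨n, e, c, hc⟩ := exists_dualBasis R M
  rw [← hc x, ← hc y]
  simp only [h]

/-- With a dual basis `(e, c)` the element is `∑ e_a φ(c_a)`. Together with `eq_of_forall_dual_eq`
this identifies a module with its bidual. -/
lemma evalDual_surjective (φ : (M →ₗ[Rᵐᵒᵖ] R) →ₗ[R] R) : ∃ x : M, ∀ f, f x = φ f := by
  obtain ⟨n, e, c, hc⟩ := exists_dualBasis R M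
  refine ⟨∑ a, MulOpposite.op (φ (c a)) • e a, fun f => ?_⟩
  have hf : f = ∑ a, f (e a) • c a := by
    ext x
    conv_lhs => rw [← hc x, map_sum]
    rw [LinearMap.sum_apply]
    refine Finset.sum_congr rfl fun a _ => ?_
    rw [map_smul]
    rfl
  conv_rhs => rw [hf, map_sum]
  rw [map_sum]
  refine Finset.sum_congr rfl fun a _ => ?_
  rw [map_smul, map_smul]
  rfl

end Reflexive

/-! ### Dimension shifting along a degreewise split sequence. -/

section Dual

variable {R : Type u} [Ring R]

instance (K : CochainComplex (Proj Rᵐᵒᵖ) ℤ) (i : ℤ) : Module.Finite Rᵐᵒᵖ (K.X i).obj :=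
  (K.X i).property.1

instance (K : CochainComplex (Proj Rᵐᵒᵖ) ℤ) (i : ℤ) : Module.Projective Rᵐᵒᵖ (K.X i).obj :=
  (K.X i).property.2

/-- Only the vanishing of `Ext^1` needs more than dimension shifting: extending forms from
`C^i(X₃^*)` to `C^i(X₂^*)` amounts to lifting cycles of degree `-i` from `X₃` to `X₂`. -/
lemma ext_one_of_ghost (S : ShortComplex (CochainComplex (Proj Rᵐᵒᵖ) ℤ))
    (σ : ∀ n, (S.map (HomologicalComplex.eval _ _ n)).Splitting)
    (h : ∀ i, Epi ((cohomology Rᵐᵒᵖ i).map ((toKProj _).map S.g)))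
    (h' : ∀ i, Epi ((cohomology R i).map ((toKProj _).map (splitDual R S).g))) (i : ℤ)
    (hP : ExtAcyclic (ModuleCat.of R R) (((toModules R).obj (splitDual R S).X₂).opcycles i)) :
    Subsingleton (Abelian.Ext (((toModules R).obj (splitDual R S).X₃).opcycles i)
      (ModuleCat.of R R) 1) ∧
    ∀ j, 1 ≤ j → (Subsingleton (Abelian.Ext (((toModules R).obj (splitDual R S).X₃).opcycles i)
      (ModuleCat.of R R) (j + 1)) ↔
        Subsingleton (Abelian.Ext (((toModules R).obj (splitDual R S).X₁).opcycles i)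
          (ModuleCat.of R R) j)) := by
  let E := (splitDual R S).map (toModules R)
  have hE : ∀ k, (E.map (HomologicalComplex.eval _ _ k)).ShortExact := fun k =>
    ((splitDualSplitting R S σ k).map (fgProjective R).ι).shortExact
  have hC := shortExact_opcycles E hE (fun k => (epi_cohomology_map_iff _ _).1 (h' k)) i
  refine ⟨ext_one_of_forall_exists hC hP ?_, fun j hj => ext_succ_iff hC hP hj⟩
  intro a
  let α : ((S.X₃.X (-i)).obj →ₗ[Rᵐᵒᵖ] R) →ₗ[R] R := (E.X₁.pOpcycles i ≫ a).hom
  obtain ⟨x, hx⟩ := evalDual_surjective α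
  -- The form `a` is evaluation at `x`; as it vanishes on boundaries of the dual complex, all forms
  -- kill `d x`.
  have hdx : (S.X₃.d (-i) (-(i - 1))).hom.hom x = 0 := by
    refine eq_of_forall_dual_eq (R := R) fun f => ?_
    refine Eq.trans ?_ (map_zero f).symm
    refine (hx (f ∘ₗ (S.X₃.d (-i) (-(i - 1))).hom.hom)).trans ?_
    exact (congrArg a.hom ((pOpcycles_eq_zero_iff (K := E.X₁) (sub_add_cancel i 1) _).2
      ⟨f, rfl⟩)).trans (map_zero a.hom)
  obtain ⟨y, w, hy, hw⟩ := (epi_homologyMap_iff ((toModules _).map S.g) (k := -(i + 1)) (i := -i)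
    (j := -(i - 1)) (by lia) (by lia)).1 ((epi_cohomology_map_iff _ _).1 (h _)) x hdx
  let y' : (S.X₂.X (-i)).obj := y
  have hy' : (S.X₂.d (-i) (-(i - 1))).hom.hom y' = 0 := hy
  let s : S.X₃.X (-(i + 1)) ⟶ S.X₂.X (-(i + 1)) := (σ (-(i + 1))).s
  have hs : s ≫ S.g.f (-(i + 1)) = 𝟙 _ := (σ (-(i + 1))).s_g
  -- A lift of the class of `x` is correct up to the boundary `d w`; lifting `w` by the degreewise
  -- section makes it a cycle mapping exactly to `x`.
  let p : (S.X₂.X (-i)).obj := y' + (S.X₂.d (-(i + 1)) (-i)).hom.hom (s.hom.hom w)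
  have hp : (S.g.f (-i)).hom.hom p = x := by
    refine (map_add _ _ _).trans (Eq.trans ?_ hw)
    congr 1
    have e : s ≫ S.X₂.d (-(i + 1)) (-i) ≫ S.g.f (-i) = S.X₃.d (-(i + 1)) (-i) := by
      rw [← S.g.comm, reassoc_of% hs]
    exact LinearMap.congr_fun (congrArg (fun φ => φ.hom.hom) e) w
  have hdp : (S.X₂.d (-i) (-(i - 1))).hom.hom p = 0 := by
    have e : S.X₂.d (-(i + 1)) (-i) ≫ S.X₂.d (-i) (-(i - 1)) = 0 := S.X₂.d_comp_d _ _ _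
    refine (map_add _ _ _).trans ?_
    rw [hy', zero_add]
    exact LinearMap.congr_fun (congrArg (fun φ => φ.hom.hom) e) _
  obtain ⟨b, hb⟩ : ∃ b : E.X₂.X i ⟶ ModuleCat.of R R,
      ∀ f : (S.X₂.X (-i)).obj →ₗ[Rᵐᵒᵖ] R, b.hom f = f p :=
    ⟨ModuleCat.ofHom (evalDual p), fun _ => rfl⟩
  have hdb : E.X₂.d (i - 1) i ≫ b = 0 := by
    ext f
    let f' : (S.X₂.X (-(i - 1))).obj →ₗ[Rᵐᵒᵖ] R := f
    refine (hb (f' ∘ₗ (S.X₂.d (-i) (-(i - 1))).hom.hom)).trans ?_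
    exact (congrArg f' hdp).trans (map_zero f')
  refine ⟨E.X₂.descOpcycles b (i - 1) (by simp) hdb, ?_⟩
  change HomologicalComplex.opcyclesMap E.f i ≫ _ = a
  rw [← cancel_epi (E.X₁.pOpcycles i), HomologicalComplex.p_opcyclesMap_assoc,
    HomologicalComplex.p_descOpcycles]
  ext f
  let f' : (S.X₃.X (-i)).obj →ₗ[Rᵐᵒᵖ] R := f
  refine (hb (f' ∘ₗ (S.g.f (-i)).hom.hom)).trans ?_
  exact (congrArg f' hp).trans (hx f')

end Dual

/-! ### Objects of `Add R` as retracts of free complexes with zero differential. -/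

section GhostProjective

variable {A : Type u} [Ring A]

/-- The complex of free modules `A^(m i)` with zero differential. -/
def freeComplex (A : Type u) [Ring A] (m : ℤ → ℕ) : CochainComplex (Proj A) ℤ where
  X i := ⟨ModuleCat.of A (Fin (m i) → A), inferInstanceAs (Module.Finite A (Fin (m i) → A)),
    inferInstanceAs (Module.Projective A (Fin (m i) → A))⟩
  d _ _ := 0

lemma exists_lift_d (K L : CochainComplex (Proj A) ℤ) (i k j : ℤ) (f : K.X i ⟶ L.X j)
    (h : ∀ x, ∃ w, (L.d k j).hom.hom w = f.hom.hom x) : ∃ g : K.X i ⟶ L.X k, g ≫ L.d k j = f := by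
  have : Module.Projective A (K.X i).obj := (K.X i).property.2
  obtain ⟨g, hg⟩ := Module.projective_lifting_property (L.d k j).hom.hom.rangeRestrict
    (f.hom.hom.codRestrict (LinearMap.range (L.d k j).hom.hom) h)
    (LinearMap.surjective_rangeRestrict _)
  refine ⟨ObjectProperty.homMk (ModuleCat.ofHom g), ?_⟩
  ext x
  exact congrArg Subtype.val (LinearMap.congr_fun hg x)

/-- Every element of `F` is a cycle, so the map takes values in boundaries; projectivity lifts it
through the differential, and the lifts form a null-homotopy. -/
lemma eq_zero_of_cohomology_map_eq_zero (F : CochainComplex (Proj A) ℤ) (hF : ∀ i j, F.d i j = 0)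
    {Z : KProj A} (ψ : (toKProj A).obj F ⟶ Z) (h : ∀ i, (cohomology A i).map ψ = 0) : ψ = 0 := by
  obtain ⟨Z, rfl⟩ := HomotopyCategory.quotient_obj_surjective Z
  obtain ⟨φ, rfl⟩ := (toKProj A).map_surjective ψ
  have key (i k : ℤ) : ∃ g : F.X i ⟶ Z.X k, (k + 1 = i → g ≫ Z.d k i = φ.f i) ∧
      (¬ k + 1 = i → g = 0) := by
    by_cases hk : k + 1 = i
    · obtain ⟨g, hg⟩ := exists_lift_d F Z i k i (φ.f i) fun x =>
        (homologyMap_eq_zero_iff ((toModules A).map φ) hk rfl).1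
          ((cohomology_map_eq_zero_iff φ i).1 (h i)) x
          (LinearMap.congr_fun (congrArg (fun f => f.hom.hom) (hF i (i + 1))) x)
      exact ⟨g, fun _ => hg, fun h => (h hk).elim⟩
    · exact ⟨0, fun h => (hk h).elim, fun _ => rfl⟩
  choose s hs₁ hs₂ using key
  have H : Homotopy φ 0 :=
    { hom := s
      zero := fun i j hij => hs₂ i j hij
      comm := fun i => by
        rw [dNext_eq s (show (ComplexShape.up ℤ).Rel i (i + 1) from rfl),
          prevD_eq s (show (ComplexShape.up ℤ).Rel (i - 1) i by simp), hF, zero_comp,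
          hs₁ _ _ (by simp)]
        simp }
  rw [HomotopyCategory.eq_of_homotopy _ _ H, Functor.map_zero]

lemma cohomology_map_shift_eq_zero {Z Z' : KProj A} (f : Z ⟶ Z')
    (h : ∀ i, (cohomology A i).map f = 0) (n i : ℤ) : (cohomology A i).map (f⟦n⟧') = 0 := by
  have e := NatIso.naturality_2 ((cohomology A 0).shiftIso n i (n + i) rfl) f
  refine e.symm.trans ((congrArg (_ ≫ · ≫ _) (h (n + i))).trans ?_)
  exact (congrArg (_ ≫ ·) zero_comp).trans comp_zero

/-- The objects from which every composition with a morphism that vanishes on cohomology is zero. -/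
def ghostProjective (A : Type u) [Ring A] : ObjectProperty (KProj A) := fun P =>
  ∀ ⦃Z Z' : KProj A⦄ (g : P ⟶ Z) (f : Z ⟶ Z'), (∀ i, (cohomology A i).map f = 0) → g ≫ f = 0

lemma ghostProjective_of_d_eq_zero (F : CochainComplex (Proj A) ℤ) (hF : ∀ i j, F.d i j = 0) :
    ghostProjective A ((toKProj A).obj F) := fun _ _ g f hf =>
  eq_zero_of_cohomology_map_eq_zero F hF _ fun i => by
    rw [Functor.map_comp, hf i]
    exact comp_zero

instance : (ghostProjective A).IsStableUnderShift ℤ where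
  isStableUnderShiftBy a :=
    { le_shift := fun P hP Z Z' g f hf => by
        -- Shifting back by `-a` is faithful, returns the source to `P`, and preserves vanishing on
        -- cohomology.
        refine (shiftFunctor (KProj A) (-a)).map_injective ?_
        rw [Functor.map_comp, Functor.map_zero]
        have e := (shiftFunctorCompIsoId (KProj A) a (-a) (by simp)).app P
        have := hP (e.inv ≫ g⟦-a⟧') (f⟦-a⟧') (cohomology_map_shift_eq_zero f hf _)
        rw [Category.assoc] at this
        exact (cancel_epi e.inv).1 (this.trans comp_zero.symm) }

instance : (ghostProjective A).IsStableUnderRetracts where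
  of_retract r hY Z Z' g f hf := by
    have := hY (r.r ≫ g) f hf
    rw [← Category.id_comp g, ← r.retract, Category.assoc, Category.assoc, ← Category.assoc r.r,
      this, comp_zero]

instance (J : Type u) : (ghostProjective A).IsClosedUnderColimitsOfShape (Discrete J) where
  colimitsOfShape_le := by
    rintro X ⟨p⟩ Z Z' g f hf
    refine p.isColimit.hom_ext fun j => ?_
    rw [comp_zero, ← Category.assoc]
    exact p.prop_diag_obj j _ f hf

lemma ghostProjective_of_addR {P : KProj A} (hP : AddR A P) : ghostProjective A P :=
  hP _ (ghostProjective_of_d_eq_zero _ fun _ _ => rfl) inferInstance inferInstance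
    fun _ => inferInstance

lemma exists_linear_generators [IsNoetherianRing A] (M : Type u) [AddCommGroup M] [Module A M]
    [Module.Finite A M] (N : Submodule A M) :
    ∃ (n : ℕ) (s : Fin n → M), (∀ a, s a ∈ N) ∧
      ∀ x ∈ N, ∃ c : Fin n → A, ∑ a, c a • s a = x := by
  obtain ⟨n, s, hs⟩ := Submodule.fg_iff_exists_fin_generating_family.1 (IsNoetherian.noetherian N)
  refine ⟨n, s, fun a => hs ▸ Submodule.subset_span ⟨a, rfl⟩, fun x hx => ?_⟩
  rw [← hs] at hx
  exact (Submodule.mem_span_range_iff_exists_fun A).1 hx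

/-- Noetherianity makes the cycles in each degree finitely generated; the free modules map onto
them. -/
lemma exists_freeComplex_cover [IsNoetherianRing A] (Y : CochainComplex (Proj A) ℤ) :
    ∃ (m : ℤ → ℕ) (φ : freeComplex A m ⟶ Y),
      ∀ i, Epi ((cohomology A i).map ((toKProj A).map φ)) := by
  have (i : ℤ) : Module.Finite A (Y.X i).obj := (Y.X i).property.1
  choose m s hs hs' using fun i => exists_linear_generators (A := A) (Y.X i).obj
    (LinearMap.ker (Y.d i (i + 1)).hom.hom)
  let φ : freeComplex A m ⟶ Y :=
    { f := fun i => ObjectProperty.homMk (ModuleCat.ofHom (Fintype.linearCombination A (s i)))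
      comm' := by
        rintro i _ rfl
        ext x
        change (Y.d i (i + 1)).hom.hom (∑ a, x a • s i a) = _
        rw [map_sum, Finset.sum_eq_zero]
        · exact (map_zero (Fintype.linearCombination A (s (i + 1)))).symm
        · intro a _
          rw [map_smul, show (Y.d i (i + 1)).hom.hom (s i a) = 0 from hs i a, smul_zero] }
  refine ⟨m, φ, fun i => ?_⟩
  rw [epi_cohomology_map_iff, epi_homologyMap_iff _ (sub_add_cancel i 1) rfl]
  intro z hz
  obtain ⟨c, hc⟩ := hs' i z hz
  exact ⟨c, 0, rfl, by rw [map_zero, add_zero]; exact hc⟩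

/-- The cone map of a cover surjective on cohomology vanishes on cohomology, hence vanishes on the
ghost-projective object `P`, and so the cover splits. -/
lemma exists_retract_freeComplex [IsNoetherianRing A] {P : KProj A} (hP : AddR A P) :
    ∃ m, Nonempty (Retract P ((toKProj A).obj (freeComplex A m))) := by
  obtain ⟨P, rfl⟩ := HomotopyCategory.quotient_obj_surjective P
  obtain ⟨m, φ, hφ⟩ := exists_freeComplex_cover P
  obtain ⟨C, g, h, hT⟩ := distinguished_cocone_triangle ((toKProj A).map φ)
  have hg : g = 0 := by
    rw [← Category.id_comp g]
    exact ghostProjective_of_addR hP _ g fun i => (epi_mor₁_iff i hT).1 (hφ i)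
  obtain ⟨s, hs⟩ := Triangle.coyoneda_exact₂ _ hT (𝟙 _) ((Category.id_comp _).trans hg)
  exact ⟨m, ⟨{ i := s, r := (toKProj A).map φ, retract := hs.symm }⟩⟩

end GhostProjective

/-! ### Free complexes with zero differential belong to `Add R`. -/

section FreeComplex

variable {A : Type u} [Ring A]

/-- The inclusion of a free module of rank one in a free complex. -/
noncomputable def freeComplexι (m : ℤ → ℕ) (i : ℤ) (a : Fin (m i)) :
    (HomologicalComplex.single (Proj A) (ComplexShape.up ℤ) i).obj (regularModule A) ⟶
      freeComplex A m :=
  HomologicalComplex.mkHomFromSingle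
    (ObjectProperty.homMk (ModuleCat.ofHom (LinearMap.single A (fun _ => A) a))) fun _ _ => comp_zero

lemma single_addR (P : ObjectProperty (KProj A)) (h : P (regularComplex A))
    [P.IsStableUnderShift ℤ] [P.IsClosedUnderIsomorphisms] (i : ℤ) :
    P ((toKProj A).obj
      ((HomologicalComplex.single (Proj A) (ComplexShape.up ℤ) i).obj (regularModule A))) := by
  have e := ((HomotopyCategory.singleFunctors (Proj A)).shiftIso (-i) i 0 (by simp)).app
    (regularModule A)
  exact P.prop_of_iso e (P.le_shift (-i) _ h)

/-- The generator of the free module of rank one, in the complex concentrated in degree `i`. -/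
noncomputable def singleOne (A : Type u) [Ring A] (i : ℤ) :
    (((HomologicalComplex.single (Proj A) (ComplexShape.up ℤ) i).obj (regularModule A)).X i).obj :=
  (HomologicalComplex.singleObjXSelf (ComplexShape.up ℤ) i (regularModule A)).inv.hom.hom (1 : A)

lemma single_hom_ext {i : ℤ} {Z : CochainComplex (Proj A) ℤ}
    {φ ψ : (HomologicalComplex.single (Proj A) (ComplexShape.up ℤ) i).obj (regularModule A) ⟶ Z}
    (h : (φ.f i).hom.hom (singleOne A i) = (ψ.f i).hom.hom (singleOne A i)) : φ = ψ := by
  apply HomologicalComplex.from_single_hom_ext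
  rw [← cancel_epi
    (HomologicalComplex.singleObjXSelf (ComplexShape.up ℤ) i (regularModule A)).inv]
  apply ObjectProperty.hom_ext
  apply ModuleCat.hom_ext
  exact LinearMap.ext_ring h

lemma freeComplexι_singleOne (m : ℤ → ℕ) (i : ℤ) (a : Fin (m i)) :
    ((freeComplexι (A := A) m i a).f i).hom.hom (singleOne A i) = Pi.single a (1 : A) := by
  have h : (HomologicalComplex.singleObjXSelf (ComplexShape.up ℤ) i (regularModule A)).inv ≫
      (freeComplexι (A := A) m i a).f i =
        ObjectProperty.homMk (ModuleCat.ofHom (LinearMap.single A (fun _ => A) a)) := by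
    exact (congrArg (_ ≫ ·) (HomologicalComplex.mkHomFromSingle_f _ _)).trans
      (Iso.inv_hom_id_assoc _ _)
  exact LinearMap.congr_fun (congrArg (fun f => f.hom.hom) h) (1 : A)

lemma exists_desc_freeComplex (m : ℤ → ℕ) (Z : CochainComplex (Proj A) ℤ)
    (τ : ∀ (i : ℤ) (_ : Fin (m i)),
      (HomologicalComplex.single (Proj A) (ComplexShape.up ℤ) i).obj (regularModule A) ⟶ Z) :
    ∃ φ : freeComplex A m ⟶ Z, ∀ i a, freeComplexι m i a ≫ φ = τ i a := by
  let z (i : ℤ) (a : Fin (m i)) : (Z.X i).obj := ((τ i a).f i).hom.hom (singleOne A i)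
  have hz (i j : ℤ) (a : Fin (m i)) : (Z.d i j).hom.hom (z i a) = 0 := by
    have h : (τ i a).f i ≫ Z.d i j = 0 := by
      rw [(τ i a).comm]
      exact zero_comp
    exact LinearMap.congr_fun (congrArg (fun f => f.hom.hom) h) _
  let φ : freeComplex A m ⟶ Z :=
    { f := fun i => ObjectProperty.homMk (ModuleCat.ofHom (Fintype.linearCombination A (z i)))
      comm' := by
        rintro i j -
        ext x
        change (Z.d i j).hom.hom (∑ a, x a • z i a) = _
        rw [map_sum, Finset.sum_eq_zero]
        · exact (map_zero (Fintype.linearCombination A (z j))).symm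
        · intro a _
          rw [map_smul, hz, smul_zero] }
  refine ⟨φ, fun i a => single_hom_ext ?_⟩
  refine (congrArg (Fintype.linearCombination A (z i)) (freeComplexι_singleOne m i a)).trans ?_
  exact (Fintype.linearCombination_apply_single A (z i) a 1).trans (one_smul _ _)

/-- This is uniqueness for the coproduct. The images of the basis elements are boundaries, so the
map is zero on cohomology, which suffices for a source with zero differential. -/
lemma freeComplex_hom_eq_zero (m : ℤ → ℕ) {Z : KProj A}
    (φ : (toKProj A).obj (freeComplex A m) ⟶ Z)
    (h : ∀ i a, (toKProj A).map (freeComplexι m i a) ≫ φ = 0) : φ = 0 := by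
  obtain ⟨Z, rfl⟩ := HomotopyCategory.quotient_obj_surjective Z
  obtain ⟨φ, rfl⟩ := (toKProj A).map_surjective φ
  refine eq_zero_of_cohomology_map_eq_zero (freeComplex A m) (fun _ _ => rfl) _ (fun i => ?_)
  rw [cohomology_map_eq_zero_iff, homologyMap_eq_zero_iff _ (sub_add_cancel i 1) rfl]
  have key (a : Fin (m i)) :
      ∃ w, (Z.d (i - 1) i).hom.hom w = (φ.f i).hom.hom (Pi.single a (1 : A)) := by
    have h₀ : (cohomology A i).map ((toKProj A).map (freeComplexι m i a ≫ φ)) = 0 := by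
      rw [Functor.map_comp, h i a, Functor.map_zero]
    obtain ⟨w, hw⟩ := (homologyMap_eq_zero_iff _ (sub_add_cancel i 1) rfl).1
      ((cohomology_map_eq_zero_iff _ i).1 h₀) (singleOne A i) rfl
    exact ⟨w, hw.trans (congrArg (φ.f i).hom.hom (freeComplexι_singleOne m i a))⟩
  choose w hw using key
  intro x _
  let x' : Fin (m i) → A := x
  refine ⟨∑ a, x' a • w a, ?_⟩
  change (Z.d (i - 1) i).hom.hom (∑ a, x' a • w a) = (φ.f i).hom.hom x'
  conv_rhs => rw [pi_eq_sum_univ' x']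
  rw [map_sum]
  refine Eq.trans ?_ (map_sum (φ.f i).hom.hom _ _).symm
  refine Finset.sum_congr rfl fun a _ => ?_
  rw [map_smul, hw]
  refine (map_smul (φ.f i).hom.hom (x' a) (Pi.single a (1 : A))).symm.trans ?_
  rfl

/-- A free complex with zero differential is the coproduct, in the homotopy category, of free
modules of rank one. -/
lemma freeComplex_isColimit (m : ℤ → ℕ) :
    Nonempty (IsColimit (Cofan.mk ((toKProj A).obj (freeComplex A m))
      fun j : ULift.{u} (Σ i, Fin (m i)) =>
        (toKProj A).map (freeComplexι m j.down.1 j.down.2))) := by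
  have key (s : Cofan fun j : ULift.{u} (Σ i, Fin (m i)) => (toKProj A).obj
      ((HomologicalComplex.single (Proj A) (ComplexShape.up ℤ) j.down.1).obj (regularModule A))) :
      ∃ φ : (toKProj A).obj (freeComplex A m) ⟶ s.pt,
        ∀ j, (toKProj A).map (freeComplexι m j.down.1 j.down.2) ≫ φ = s.inj j := by
    obtain ⟨Z, hZ⟩ := HomotopyCategory.quotient_obj_surjective s.pt
    choose τ hτ using fun j => (toKProj A).map_surjective (s.inj j ≫ eqToHom hZ.symm)
    obtain ⟨φ, hφ⟩ := exists_desc_freeComplex m Z fun i a => τ ⟨i, a⟩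
    refine ⟨(toKProj A).map φ ≫ eqToHom hZ, fun j => ?_⟩
    rw [← Category.assoc, ← Functor.map_comp, hφ]
    refine (congrArg (· ≫ eqToHom hZ) (hτ j)).trans ?_
    simp
  choose φ hφ using key
  refine ⟨Cofan.IsColimit.mk _ φ hφ fun s ψ hψ => sub_eq_zero.1 (freeComplex_hom_eq_zero m _ ?_)⟩
  intro i a
  rw [Preadditive.comp_sub, sub_eq_zero]
  exact (hψ ⟨i, a⟩).trans (hφ s ⟨i, a⟩).symm

lemma freeComplex_addR (m : ℤ → ℕ) : AddR A ((toKProj A).obj (freeComplex A m)) := by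
  intro P h₁ h₂ h₃ h₄
  obtain ⟨hc⟩ := freeComplex_isColimit (A := A) m
  -- The countable index set is lifted to the universe over which the closure condition of `AddR`
  -- ranges.
  have := h₄ (ULift (Σ i, Fin (m i)))
  exact P.prop_of_isColimit hc fun j => single_addR P h₁ _

end FreeComplex

/-! ### Ext-acyclicity of the duals of objects of `Add R`. -/

section DualFree

variable {R : Type u} [Ring R]

lemma extAcyclic_dual_freeComplex (m : ℤ → ℕ) (N : ModuleCat.{u} R) (i : ℤ) :
    ExtAcyclic N (cokernelModule ((dualK R).obj (op ((toKProj _).obj (freeComplex Rᵐᵒᵖ m)))) i) := by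
  let K := (toModules R).obj ((dualComplex R).obj (op (freeComplex Rᵐᵒᵖ m)))
  -- The dual differential is zero as well, so `C^i` is the projective module in degree `i`.
  have := K.isIso_pOpcycles (i - 1) i (by simp) (by
    ext f
    exact LinearMap.comp_zero _)
  have : Projective (K.opcycles i) := Projective.of_iso (asIso (K.pOpcycles i)) inferInstance
  exact extAcyclic_of_projective N (K.opcycles i)

lemma extAcyclic_dual_of_addR [IsNoetherianRing Rᵐᵒᵖ] {P : KProj Rᵐᵒᵖ} (hP : AddR Rᵐᵒᵖ P)
    (N : ModuleCat.{u} R) (i : ℤ) :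
    ExtAcyclic N (cokernelModule ((dualK R).obj (op P)) i) := by
  obtain ⟨m, ⟨r⟩⟩ := exists_retract_freeComplex hP
  let r' : Retract ((dualK R).obj (op P)) ((dualK R).obj (op ((toKProj _).obj (freeComplex Rᵐᵒᵖ m)))) :=
    { i := (dualK R).map r.r.op
      r := (dualK R).map r.i.op
      retract := by rw [← Functor.map_comp, ← op_comp, r.retract]; exact (dualK R).map_id _ }
  intro j hj
  exact ext_cokernelModule_of_retract r' N i hj (extAcyclic_dual_freeComplex m N i j hj)

end DualFree

/-! ### Torsionfreeness along ghost triangles and construction of resolutions. -/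

section Resolutions

variable {R : Type u} [Ring R]

lemma ext_cokernelModule_dual_iff {X Y : KProj Rᵐᵒᵖ} (e : X ≅ Y) (N : ModuleCat.{u} R) (i : ℤ)
    {j : ℕ} (hj : 1 ≤ j) :
    Subsingleton (Abelian.Ext (cokernelModule ((dualK R).obj (op X)) i) N j) ↔
      Subsingleton (Abelian.Ext (cokernelModule ((dualK R).obj (op Y)) i) N j) :=
  ⟨ext_cokernelModule_of_retract ((dualK R).mapIso e.op).retract N i hj,
    ext_cokernelModule_of_retract ((dualK R).mapIso e.symm.op).retract N i hj⟩

lemma isTorsionfree_iff_of_iso {X Y : KProj Rᵐᵒᵖ} (e : X ≅ Y) (n : ℕ) :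
    IsTorsionfree n X ↔ IsTorsionfree n Y :=
  forall_congr' fun i => forall_congr' fun _ => forall_congr' fun hj => forall_congr' fun _ =>
    ext_cokernelModule_dual_iff e _ i hj

lemma ext_of_ghost_triangle [IsNoetherianRing Rᵐᵒᵖ] {T : Triangle (KProj Rᵐᵒᵖ)}
    (hT : IsCohomologicallyGhost T) (hT' : IsCohomologicallyGhost (dualTriangle R T))
    (hP : AddR Rᵐᵒᵖ T.obj₂) (i : ℤ) :
    Subsingleton (Abelian.Ext (cokernelModule ((dualK R).obj (op T.obj₁)) i)
      (ModuleCat.of R R) 1) ∧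
    ∀ j, 1 ≤ j → (Subsingleton (Abelian.Ext (cokernelModule ((dualK R).obj (op T.obj₁)) i)
      (ModuleCat.of R R) (j + 1)) ↔
        Subsingleton (Abelian.Ext (cokernelModule ((dualK R).obj (op T.obj₃)) i)
          (ModuleCat.of R R) j)) := by
  obtain ⟨S, σ, ⟨e⟩⟩ :=
    (HomotopyCategory.distinguished_iff_iso_trianglehOfDegreewiseSplit T).1 hT.distinguished
  let e₁ : T.obj₁ ≅ (toKProj _).obj S.X₁ := Triangle.π₁.mapIso e
  let e₂ : T.obj₂ ≅ (toKProj _).obj S.X₂ := Triangle.π₂.mapIso e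
  let e₃ : T.obj₃ ≅ (toKProj _).obj S.X₃ := Triangle.π₃.mapIso e
  have hf : (toKProj _).map S.f = e₁.inv ≫ T.mor₁ ≫ e₂.hom :=
    (Iso.eq_inv_comp _).2 e.hom.comm₁.symm
  have hg : (toKProj _).map S.g = e₂.inv ≫ T.mor₂ ≫ e₃.hom :=
    (Iso.eq_inv_comp _).2 e.hom.comm₂.symm
  have key := ext_one_of_ghost S σ (fun i => by
      have : Epi ((cohomology Rᵐᵒᵖ i).map T.mor₂) := (hT.shortExact i).choose_spec.epi_g
      rw [hg, Functor.map_comp, Functor.map_comp]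
      infer_instance) (fun i => by
      have : Epi ((cohomology R i).map ((dualK R).map T.mor₁.op)) :=
        (hT'.shortExact i).choose_spec.epi_g
      change Epi ((cohomology R i).map ((dualK R).map ((toKProj _).map S.f).op))
      rw [hf, op_comp, op_comp, Functor.map_comp, Functor.map_comp, Functor.map_comp,
        Functor.map_comp]
      infer_instance) i (fun j hj => (ext_cokernelModule_dual_iff e₂ _ i hj).1
        (extAcyclic_dual_of_addR hP _ i j hj))
  refine ⟨(ext_cokernelModule_dual_iff e₁ _ i le_rfl).2 key.1, fun j hj => ?_⟩
  rw [ext_cokernelModule_dual_iff e₁ _ i (by lia : 1 ≤ j + 1),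
    ext_cokernelModule_dual_iff e₃ _ i hj]
  exact key.2 j hj

lemma isTorsionfree_succ_iff [IsNoetherianRing Rᵐᵒᵖ] {T : Triangle (KProj Rᵐᵒᵖ)}
    (hT : IsCohomologicallyGhost T) (hT' : IsCohomologicallyGhost (dualTriangle R T))
    (hP : AddR Rᵐᵒᵖ T.obj₂) (n : ℕ) : IsTorsionfree (n + 1) T.obj₁ ↔ IsTorsionfree n T.obj₃ := by
  have key := ext_of_ghost_triangle hT hT' hP
  constructor
  · intro h i j hj hjn
    exact ((key i).2 j hj).1 (h i (j + 1) (by lia) (by lia))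
  · intro h i j hj hjn
    obtain rfl | ⟨k, rfl⟩ : j = 1 ∨ ∃ k, j = (k + 1) + 1 := by
      rcases j with _ | _ | k
      · lia
      · exact .inl rfl
      · exact .inr ⟨k, rfl⟩
    · exact (key i).1
    · exact ((key i).2 (k + 1) (by lia)).2 (h i (k + 1) (by lia) (by lia))

/-- The linear map to a free module whose components are given linear forms. -/
def toFree {M : Type u} [AddCommGroup M] [Module Rᵐᵒᵖ M] {n : ℕ} (z : Fin n → M →ₗ[Rᵐᵒᵖ] R) :
    M →ₗ[Rᵐᵒᵖ] (Fin n → Rᵐᵒᵖ) where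
  toFun x a := MulOpposite.op (z a x)
  map_add' x y := by ext a; simp
  map_smul' r x := by ext a; simp

/-- The linear form on a free right module with given coefficients. -/
def freeForm {n : ℕ} (c : Fin n → R) : (Fin n → Rᵐᵒᵖ) →ₗ[Rᵐᵒᵖ] R where
  toFun v := ∑ a, c a * (v a).unop
  map_add' v w := by simp [mul_add, Finset.sum_add_distrib]
  map_smul' r v := by simp [Finset.sum_mul, mul_assoc]

/-- The components of `φ` in degree `i` generate the forms on `X^i` that vanish on boundaries, that
is, the cycles of `X^*` in degree `-i`. These are finitely generated because `R` is left noetherian.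
-/
lemma exists_freeComplex_preenvelope [IsNoetherianRing R] (X : CochainComplex (Proj Rᵐᵒᵖ) ℤ)
    (hX : IsTorsionfree 1 ((toKProj _).obj X)) :
    ∃ (m : ℤ → ℕ) (φ : X ⟶ freeComplex Rᵐᵒᵖ m),
      (∀ i, Mono ((cohomology Rᵐᵒᵖ i).map ((toKProj _).map φ))) ∧
        ∀ i, Epi ((cohomology R i).map ((dualK R).map ((toKProj _).map φ).op)) := by
  have (i : ℤ) := (dual_finite R (X.X i).obj).1
  let Z (i : ℤ) : Submodule R ((X.X i).obj →ₗ[Rᵐᵒᵖ] R) :=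
    { carrier := {z | ∀ j w, z ((X.d j i).hom.hom w) = 0}
      add_mem' := fun {a b} ha hb j w => by simp [ha j w, hb j w]
      zero_mem' := fun _ _ => rfl
      smul_mem' := fun r a ha j w => by simp [ha j w] }
  choose m z hz hz' using fun i => exists_linear_generators _ (Z i)
  let φ : X ⟶ freeComplex Rᵐᵒᵖ m :=
    { f := fun i => ObjectProperty.homMk (ModuleCat.ofHom (toFree (z i)))
      comm' := by
        rintro i j -
        ext x
        refine Eq.symm (funext fun a => ?_)
        exact congrArg MulOpposite.op (hz j a i x) }
  refine ⟨m, φ, fun i => ?_, fun i => ?_⟩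
  · obtain ⟨k, rfl⟩ : ∃ k, i = -k := ⟨-i, by simp⟩
    rw [mono_cohomology_map_iff, mono_homologyMap_iff _ (k := -(k + 1)) (j := -(k - 1))
      (by lia) (by lia)]
    intro x hx w hw
    let x' : (X.X (-k)).obj := x
    -- The target has zero differential, so `hw` says that `φ` kills `x`.
    have hzx (a : Fin (m (-k))) : z (-k) a x' = 0 :=
      MulOpposite.op_injective (congrFun hw.symm a)
    let K := (toModules R).obj ((dualComplex R).obj (op X))
    have hext : Subsingleton (Abelian.Ext (K.opcycles (k + 1)) (ModuleCat.of R R) 1) :=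
      hX (k + 1) 1 le_rfl le_rfl
    -- Evaluation at `x` vanishes on the cycles of `X^*`, hence factors through its differential. By
    -- reflexivity the factor is evaluation at some `v`, and then `d v = x`.
    obtain ⟨g, hg⟩ := exists_d_comp_eq K (ModuleCat.of R R) (i := k) rfl
      (show ((X.X (-k)).obj →ₗ[Rᵐᵒᵖ] R) →ₗ[R] R from evalDual x') (by
        intro f hf
        let f' : (X.X (-k)).obj →ₗ[Rᵐᵒᵖ] R := f
        have hf' : f' ∈ Z (-k) := by
          intro j w
          by_cases hj : j = -(k + 1)
          · subst hj
            exact LinearMap.congr_fun hf w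
          · rw [X.shape j (-k) (by change ¬ j + 1 = -k; lia)]
            exact map_zero f'
        obtain ⟨c, hc⟩ := hz' (-k) f' hf'
        change f' x' = 0
        rw [← hc]
        simp [hzx])
    let g' : ((X.X (-(k + 1))).obj →ₗ[Rᵐᵒᵖ] R) →ₗ[R] R := g
    obtain ⟨v, hv⟩ := evalDual_surjective g'
    refine ⟨v, eq_of_forall_dual_eq (R := R) (M := (X.X (-k)).obj) fun f => ?_⟩
    exact (hv (f ∘ₗ (X.d (-(k + 1)) (-k)).hom.hom)).trans (hg f)
  · rw [dualK_map_quotient]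
    change Epi ((cohomology R i).map ((toKProj R).map ((dualComplex R).map φ.op)))
    rw [epi_cohomology_map_iff, epi_homologyMap_iff _ (sub_add_cancel i 1) rfl]
    intro f hf
    let f' : (X.X (-i)).obj →ₗ[Rᵐᵒᵖ] R := f
    have hf' : f' ∈ Z (-i) := by
      intro j w
      by_cases hj : j = -(i + 1)
      · subst hj
        exact LinearMap.congr_fun hf w
      · rw [X.shape j (-i) (by change ¬ j + 1 = -i; lia)]
        exact map_zero f'
    obtain ⟨c, hc⟩ := hz' (-i) f' hf'
    -- The dual map is already onto on cycles: a cycle `∑ c_a z_a` is the image of the form with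
    -- coefficients `c`, so no boundary is needed.
    refine ⟨freeForm c, 0, LinearMap.comp_zero (freeForm c), ?_⟩
    rw [map_zero, add_zero]
    change freeForm c ∘ₗ toFree (z (-i)) = f'
    rw [← hc]
    ext x
    simp [freeForm, toFree]

lemma exists_ghost_triangle [IsNoetherianRing R] {X : KProj Rᵐᵒᵖ} (hX : IsTorsionfree 1 X) :
    ∃ (P X' : KProj Rᵐᵒᵖ) (f : X ⟶ P) (g : P ⟶ X') (h : X' ⟶ X⟦(1 : ℤ)⟧), AddR Rᵐᵒᵖ P ∧
      IsCohomologicallyGhost (Triangle.mk f g h) ∧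
      IsCohomologicallyGhost (dualTriangle R (Triangle.mk f g h)) := by
  obtain ⟨X, rfl⟩ := HomotopyCategory.quotient_obj_surjective X
  obtain ⟨m, φ, hφ, hφ'⟩ := exists_freeComplex_preenvelope X hX
  obtain ⟨C, g, h, hT⟩ := distinguished_cocone_triangle ((toKProj _).map φ)
  exact ⟨_, C, (toKProj _).map φ, g, h, freeComplex_addR m, isCohomologicallyGhost_of_mono hT hφ,
    isCohomologicallyGhost_of_epi (dualTriangle_distinguished R _ hT) hφ'⟩

lemma exists_resolution [IsNoetherianRing R] [IsNoetherianRing Rᵐᵒᵖ] (n : ℕ) :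
    ∀ X : KProj Rᵐᵒᵖ, IsTorsionfree n X →
      ∃ Y P : ℕ → KProj Rᵐᵒᵖ, Y 0 = X ∧
        ∀ i < n, AddR Rᵐᵒᵖ (P i) ∧
          ∃ (f : Y i ⟶ P i) (g : P i ⟶ Y (i + 1)) (h : Y (i + 1) ⟶ (Y i)⟦(1 : ℤ)⟧),
            IsCohomologicallyGhost (Triangle.mk f g h) ∧
            IsCohomologicallyGhost (dualTriangle R (Triangle.mk f g h)) := by
  induction n with
  | zero => exact fun X _ => ⟨fun _ => X, fun _ => X, rfl, fun i hi => (Nat.not_lt_zero i hi).elim⟩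
  | succ n ih =>
    intro X hX
    obtain ⟨P₀, X', f, g, h, hP₀, hT, hT'⟩ :=
      exists_ghost_triangle fun i j hj hj' => hX i j hj (by lia)
    obtain ⟨Y, P, rfl, hY⟩ := ih X' ((isTorsionfree_succ_iff hT hT' hP₀ n).1 hX)
    -- The new triangle is put in front of the resolution of `X'`.
    refine ⟨fun k => k.casesOn X Y, fun k => k.casesOn P₀ P, rfl, fun i hi => ?_⟩
    cases i with
    | zero => exact ⟨hP₀, f, g, h, hT, hT'⟩
    | succ i => exact hY i (by lia)

lemma isTorsionfree_of_resolution [IsNoetherianRing Rᵐᵒᵖ] (n : ℕ) :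
    ∀ Y P : ℕ → KProj Rᵐᵒᵖ,
      (∀ i < n, AddR Rᵐᵒᵖ (P i) ∧
        ∃ (f : Y i ⟶ P i) (g : P i ⟶ Y (i + 1)) (h : Y (i + 1) ⟶ (Y i)⟦(1 : ℤ)⟧),
          IsCohomologicallyGhost (Triangle.mk f g h) ∧
          IsCohomologicallyGhost (dualTriangle R (Triangle.mk f g h))) →
      IsTorsionfree n (Y 0) := by
  induction n with
  | zero => exact fun Y P _ i j hj hj' => by lia
  | succ n ih =>
    intro Y P hY
    obtain ⟨hP, f, g, h, hT, hT'⟩ := hY 0 (by lia)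
    exact (isTorsionfree_succ_iff hT hT' hP n).2
      (ih (fun k => Y (k + 1)) (fun k => P (k + 1)) fun i hi => hY (i + 1) (by lia))

end Resolutions

end StableComplex

theorem theorem5p5 {R : Type u} [Ring R] [IsNoetherianRing R] [IsNoetherianRing Rᵐᵒᵖ]
    (X : StableComplex.KProj Rᵐᵒᵖ) (n : ℕ) (hn : 1 ≤ n) :
    StableComplex.IsTorsionfree n X ↔
      ∃ Y P : ℕ → StableComplex.KProj Rᵐᵒᵖ, Nonempty (X ≅ Y 0) ∧
        ∀ i < n, StableComplex.AddR Rᵐᵒᵖ (P i) ∧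
          ∃ (f : Y i ⟶ P i) (g : P i ⟶ Y (i + 1)) (h : Y (i + 1) ⟶ (Y i)⟦(1 : ℤ)⟧),
            StableComplex.IsCohomologicallyGhost (Triangle.mk f g h) ∧
            StableComplex.IsCohomologicallyGhost
              (StableComplex.dualTriangle R (Triangle.mk f g h)) := by
  constructor
  · intro hX
    obtain ⟨Y, P, rfl, h⟩ := StableComplex.exists_resolution n X hX
    exact ⟨Y, P, ⟨Iso.refl _⟩, h⟩
  · rintro ⟨Y, P, ⟨e⟩, h⟩
    exact (StableComplex.isTorsionfree_iff_of_iso e n).2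
      (StableComplex.isTorsionfree_of_resolution n Y P h)
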